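/- **Definitions.** A sequence on $m$ blocks is a concatenation of $m$ (possibly empty) blocks, each consisting of pairwise distinct letters. It avoids alternations of length $s$ if no two distinct letters $a,b$ have the alternation $abab\cdots$ of length $s$ as a subsequence (for $s=5$: it avoids $ababa$). Let $A_{s,k}(m)\in\{0,1,2,\dots,\infty\}$ be the maximum number of distinct letters in a sequence on $m$ blocks that avoids alternations of length $s$ and in which every letter occurs at least $k$ times. Let $A_1(n)=2n$ and, for $k\ge 2$, $A_k(0)=1$ and $A_k(n)=A_{k-1}(A_k(n-1))$ for $n\ge1$; let $\alpha_k(x)=\min\{n: A_k(n)\ge x\}$. For $d,m\ge 1$ define a sequence of blocks $G_d(m)$, some of whose blocks are called special and the others regular, as follows. * $G_1(m)$ is the concatenation of $m+1$ fans, with one letter for every pair of fans, occurring in exactly these two fans. Fan $i$ is the concatenation of two palindromes, each consisting of two blocks of equal length. The first block of the first palindrome consists of the letters whose last fan is $i$, in reverse order of their first fans; the first block of the second palindrome consists of the letters whose first fan is $i$, in order of their last fans. The second block of the first palindrome and the first block of the second palindrome are joined into one block, which is the special block of the fan. * For $d\ge 2$, $G_d(1)$ is $2d+2$ one-letter blocks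 with the same letter, the first and last of them special, with one empty regular block before and one after them. * For $d,m\ge2$ let $f$ be the number of special blocks of $G_d(m-1)$, let $Y=G_{d-1}(f)$, and let $X_1,X_2,\dots$ be copies of $G_d(m-1)$, one for each special block $B_1,B_2,\dots$ of $Y$, having no letters in common with $Y$ or each other. For all $i,l$, let $a$ be the $l$-th letter of $B_i$. If this is the first occurrence of $a$ in $Y$, insert $aa$ right after the $l$-th special block of $X_i$; otherwise (it is then the last occurrence) insert $aa$ right before the $l$-th special block of $X_i$. In both cases one of the two inserted letters joins the special block and the other one the adjacent regular block. Replacing every $B_i$ in $Y$ by the modified $X_i$ gives $G_d(m)$. **Statement.** 1. For all $d,m\ge1$, in each block of $G_d(m)$ the letters are pairwise distinct, every letter of $G_d(m)$ occurs exactly $2d+2$ times, and $G_d(m)$ avoids $ababa$. 2. $A_{5,6}(m)=\Omega(m\log\log m)$. There is an absolute constant $c>0$ such that, for every $d\ge3$, $A_{5,2d+2}(m)\ge \frac{c}{d}\,m\,\alpha_d(m)$ for all sufficiently large $m$ (depending on $d$). 3. $A_{5,6}(m)=O(m\log\log m)$, and $A_{5,2d+2}(m)=O(m\,\alpha_d(m))$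 for every fixed $d\ge3$. Hence $A_{5,6}(m)=\Theta(m\log\log m)$ and $A_{5,2d+2}(m)=\Theta(m\,\alpha_d(m))$ for every fixed $d\ge3$. -/

import Mathlib

open Filter
open scoped ENNReal

namespace BlockSeq

/-! ### Sequences on blocks, alternations, and the extremal function

A sequence on `m` blocks is a list of `m` (possibly empty) lists of letters; the underlying word is
its concatenation `List.flatten`.  Every word is finite, so natural numbers suffice as letters. -/

/-- The alternation `a b a b ...` of length `s`, starting with `a`. -/
def alternation (a b : ℕ) : ℕ → List ℕ
  | 0 => []
  | s + 1 => a :: alternation b a s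

/-- No subsequence of the word `w` is an alternation of length `s` of two distinct letters. -/
def AvoidsAlternation (s : ℕ) (w : List ℕ) : Prop :=
  ∀ a b : ℕ, a ≠ b → ¬ List.Sublist (alternation a b s) w

/-- In every block the letters are pairwise distinct. -/
def DistinctInBlocks (B : List (List ℕ)) : Prop :=
  ∀ b ∈ B, b.Nodup

/-- The sequences over which the maximum `A_{s,k}(m)` is taken: `m` blocks of pairwise distinct
letters, at least `k` occurrences of every letter, no alternation of length `s`. -/
structure Admissible (s k m : ℕ) (B : List (List ℕ)) : Prop where
  length_eq : B.length = m
  distinct : DistinctInBlocks B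
  occurrences : ∀ a ∈ B.flatten, k ≤ B.flatten.count a
  avoids : AvoidsAlternation s B.flatten

/-- The maximum number `A_{s,k}(m)` of distinct letters; it is `⊤` if there is no maximum. -/
noncomputable def maxLetters (s k m : ℕ) : ℕ∞ :=
  ⨆ (B : List (List ℕ)) (_ : Admissible s k m B), (B.flatten.toFinset.card : ℕ∞)

/-! ### The Ackermann hierarchy and its inverses -/

/-- The hierarchy `A_1(n) = 2n`, and `A_k(0) = 1`, `A_k(n) = A_{k-1}(A_k(n-1))` for `k ≥ 2`, so that
`A_k(n)` is the value at `1` of the `n`-fold iterate of `A_{k-1}`.  The value at `k = 0` is a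
dummy. -/
def hier : ℕ → ℕ → ℕ
  | 0 => fun _ => 0
  | 1 => fun n => 2 * n
  | k + 2 => fun n => (hier (k + 1))^[n] 1

theorem hier_one (n : ℕ) : hier 1 n = 2 * n := rfl

theorem hier_zero (k : ℕ) : hier (k + 2) 0 = 1 := rfl

theorem hier_succ (k n : ℕ) : hier (k + 2) (n + 1) = hier (k + 1) (hier (k + 2) n) := by
  simp only [hier, Function.iterate_succ_apply']

/-- The inverse function `α_k(x) = min {n : A_k(n) ≥ x}`. -/
noncomputable def invHier (k x : ℕ) : ℕ :=
  sInf {n : ℕ | x ≤ hier k n}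

theorem lt_hier (k : ℕ) : ∀ n : ℕ, 1 ≤ n → n < hier (k + 1) n := by
  induction k with
  | zero => intro n hn; rw [hier_one]; omega
  | succ k ihk =>
    have key : ∀ n : ℕ, n < hier (k + 2) n := by
      intro n
      induction n with
      | zero => rw [hier_zero]; omega
      | succ n ih =>
        have h := ihk (hier (k + 2) n) (by omega)
        rw [hier_succ]; omega
    exact fun n _ => key n

/-- The minimum that defines `α_k(x)` exists for every `k ≥ 1`. -/
theorem le_hier_invHier (k x : ℕ) : x ≤ hier (k + 1) (invHier (k + 1) x) :=
  Nat.sInf_mem (s := {n : ℕ | x ≤ hier (k + 1) n})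
    ⟨x + 1, (Nat.le_succ x).trans (lt_hier k (x + 1) (by omega)).le⟩

/-! ### The sequences `G_d(m)` -/

/-- Some blocks of `G_d(m)` are special.  Each special block has a regular block on both sides, and
no regular block has special blocks on both sides.  So the blocks are listed in groups: a single
regular block, or a special block with the regular blocks on its two sides. -/
inductive Segment
  | plain (b : List ℕ)
  | triple (left special right : List ℕ)

/-- The blocks of a segment, in order. -/
def Segment.blocks : Segment → List (List ℕ)
  | .plain b => [b]
  | .triple l s r => [l, s, r]

/-- Renaming of the letters of a segment. -/
def Segment.rename (f : ℕ → ℕ) : Segment → Segment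
  | .plain b => .plain (b.map f)
  | .triple l s r => .triple (l.map f) (s.map f) (r.map f)

/-- The blocks of a list of segments, in order. -/
def blocks (X : List Segment) : List (List ℕ) :=
  X.flatMap Segment.blocks

/-- The number of special blocks. -/
def numSpecial : List Segment → ℕ
  | [] => 0
  | .plain _ :: X => numSpecial X
  | .triple _ _ _ :: X => numSpecial X + 1

/-- The fan with number `i` among the fans `0, ..., m`.  The letter of the pair of fans `j < i` is
`Nat.pair j i`.  The fan is a palindrome on the letters with last appearance in fan `i`, followed by
a palindrome on the letters with first appearance in fan `i`; each palindrome has two blocks, and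
the two adjacent middle blocks are joined to the special block of the fan. -/
def fan (m i : ℕ) : Segment :=
  let p := ((List.range i).map fun j => Nat.pair j i).reverse
  let q := (List.range' (i + 1) (m - i)).map fun j => Nat.pair i j
  .triple p (p.reverse ++ q) q.reverse

/-- `G_1(m)`: the concatenation of `m + 1` fans. -/
def fans (m : ℕ) : List Segment :=
  (List.range (m + 1)).map (fan m)

/-- `G_d(1)`: there are `2d + 2` blocks with the same single letter, the first and the last of them
special, with one empty regular block before and one after them. -/
def constant (d : ℕ) : List Segment :=
  .triple [] [0] [0] :: (List.replicate (2 * d - 2) (.plain [0]) ++ [.triple [0] [0] []])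

/-- `insertPairs seen A X` inserts `aa`, where `a` is the `l`-th letter of `A`, next to the `l`-th
special block of `X`, for every `l`: right before that special block if `a` is in `seen`, and right
after it otherwise.  One of the two copies joins the special block, the other one the adjacent
regular block. -/
def insertPairs (seen : List ℕ) : List ℕ → List Segment → List Segment
  | _, [] => []
  | [], X => X
  | a :: A, .plain b :: X => .plain b :: insertPairs seen (a :: A) X
  | a :: A, .triple l s r :: X =>
    (if a ∈ seen then .triple (l ++ [a]) (a :: s) r else .triple l (s ++ [a]) (a :: r)) ::
      insertPairs seen A X

/-- Replace the successive special blocks `A_i`, `A_{i+1}`, ... of `Y` by copies `X_i`, `X_{i+1}`,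
... of `X` with fresh letters, into which the letters of the replaced special block are inserted in
pairs.  Here `seen` lists the letters that occur before the part `Y` of the sequence; a letter of a
special block is a first occurrence if it has not been seen before, and a last occurrence
otherwise. -/
def substitute (X : List Segment) : ℕ → List ℕ → List Segment → List Segment
  | _, _, [] => []
  | i, seen, .plain b :: Y => .plain b :: substitute X i (seen ++ b) Y
  | i, seen, .triple l s r :: Y =>
    .plain l :: (insertPairs (seen ++ l) s (X.map (Segment.rename (Nat.pair (i + 1)))) ++
      .plain r :: substitute X (i + 1) (seen ++ l ++ s ++ r) Y)

/-- The sequences `G_d(m)` for `d, m ≥ 1` (the values at `d = 0` or `m = 0` are dummies).  For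
`d, m ≥ 2`, the special blocks of `Y = G_{d-1}(f)`, where `f` is the number of special blocks of
`G_d(m-1)`, are replaced by modified copies of `G_d(m-1)`.  The letters of `Y` are renamed by
`Nat.pair 0`, those of the `i`-th copy (counted from `0`) by `Nat.pair (i + 1)`. -/
def G : ℕ → ℕ → List Segment
  | 0, _ => []
  | 1, m => fans m
  | _ + 2, 0 => []
  | d + 2, 1 => constant (d + 2)
  | d + 2, m + 2 =>
    substitute (G (d + 2) (m + 1)) 0 []
      ((G (d + 1) (numSpecial (G (d + 2) (m + 1)))).map (Segment.rename (Nat.pair 0)))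
termination_by d m => (d, m)

end BlockSeq

namespace BlockSeq

/-! ### Upper bounds -/

/-! Upper bounds. Write `N_k(m)` for the best bound `LettersLE k m`. Cut `b * t` blocks into `b`
groups of `t` blocks. Letters confined to one group number at most `N_{k+2}(t)` per group. Every
other letter either can be charged to a block, where each block is charged at most twice because a
further charge would create `ababa`, or it occurs at most twice in its first and last groups and at
most once in each other group. Contracting each group to a single block then costs such a letter at
most two occurrences. Hence `N_{k+2}(b*t) ≤ b*N_{k+2}(t) + N_k(b) + 2*b*t` (`LettersLE.mul`).

With `N_4(b) ≤ b^2` (`lettersLE_four`) and `b = t`, squaring the number of blocks adds 3 letters per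
block, which gives `log log`. For more occurrences, the contracted sequence has `O(b*t)` letters as
long as the inverse function of the previous level is at most `t` at `b`. So a bounded number of
letters per block pays for a passage from `t = A_d(n)` to `A_{d-1}(t) = A_d(n+1)`, and `α_d` such
passages reach every number of blocks (`lettersLE_invHier_succ`).

Lower bounds. The invariant `Good` says that each letter is in special blocks exactly at its first
and last occurrences, that it has `2d` occurrences in between, and that all special blocks of
`G_d(m)` have `m` letters. Substitution turns both extreme occurrences of an outer letter into
pairs, adding two occurrences. Alternations are excluded by cutting the word into four runs, each of
which misses one of the two letters (`exists_runs_substitute`, `exists_runs_fans`), or by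
restricting it to the outer letters or to one copy.

A fraction of at least `1/(4d)` of the blocks is special (`length_blocks_G_le`), and a letter is in
only two special blocks, so there are at least `m/(8d)` letters per block. The number of special
blocks is at most `A_d(2m-1)` for `d ≥ 3` and at most `2^2^m` for `d = 2` and `m ≥ 2`, so `m` is of
order at least `α_d` or `log log` of the number of blocks. Disjoint copies and empty blocks fill all
other lengths. -/

/-- The concatenation of the blocks `B n, ..., B (m - 1)`. -/
def tailWord (B : ℕ → List ℕ) (m n : ℕ) : List ℕ :=
  (List.range' n (m - n)).flatMap B

/-- The concatenation of the blocks `B 0, ..., B (m - 1)`. -/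
def word (B : ℕ → List ℕ) (m : ℕ) : List ℕ :=
  (List.range m).flatMap B

theorem tailWord_zero (B : ℕ → List ℕ) (m : ℕ) : tailWord B m 0 = word B m := by
  simp [tailWord, word, List.range_eq_range']

/-- Forbidden alternations are assembled from left to right with this lemma: `u` holds the letters
used from block `i`, and the rest comes from later blocks. -/
theorem append_sublist_tailWord {B : ℕ → List ℕ} {m n i : ℕ} {u v : List ℕ} (hn : n ≤ i)
    (hi : i < m) (hu : List.Sublist u (B i)) (hv : List.Sublist v (tailWord B m (i + 1))) :
    List.Sublist (u ++ v) (tailWord B m n) := by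
  have h : List.range' n (m - n)
      = List.range' n (i - n) ++ (i :: List.range' (i + 1) (m - (i + 1))) := by
    have h1 : m - n = (i - n) + ((m - (i + 1)) + 1) := by omega
    rw [h1, ← List.range'_append_1, List.range'_succ]
    have h2 : n + (i - n) = i := by omega
    rw [h2]
  rw [tailWord, h, List.flatMap_append, List.flatMap_cons]
  exact (hu.append hv).trans (List.sublist_append_right _ _)

theorem cons_sublist_tailWord {B : ℕ → List ℕ} {m n i a : ℕ} {v : List ℕ} (hn : n ≤ i)
    (hi : i < m) (ha : a ∈ B i) (hv : List.Sublist v (tailWord B m (i + 1))) :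
    List.Sublist (a :: v) (tailWord B m n) :=
  append_sublist_tailWord (u := [a]) hn hi (List.singleton_sublist.2 ha) hv

/-- The order of two letters inside a shared block decides which of `ababa` and `babab` arises in
the charging arguments. -/
theorem pair_sublist_or {a b : ℕ} {l : List ℕ} (hab : a ≠ b) (ha : a ∈ l) (hb : b ∈ l) :
    List.Sublist [a, b] l ∨ List.Sublist [b, a] l := by
  induction l with
  | nil => simp at ha
  | cons c l ih =>
    rcases List.mem_cons.1 ha with rfl | ha'
    · rcases List.mem_cons.1 hb with rfl | hb'
      · exact absurd rfl hab
      · exact Or.inl ((List.singleton_sublist.2 hb').cons_cons _)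
    · rcases List.mem_cons.1 hb with rfl | hb'
      · exact Or.inr ((List.singleton_sublist.2 ha').cons_cons _)
      · exact (ih ha' hb').imp (fun h => h.cons _) (fun h => h.cons _)

theorem mem_word {B : ℕ → List ℕ} {m a : ℕ} : a ∈ word B m ↔ ∃ i < m, a ∈ B i := by
  simp [word, List.mem_flatMap]

/-- The set of the blocks that contain a letter. -/
def occ (B : ℕ → List ℕ) (m a : ℕ) : Finset ℕ :=
  (Finset.range m).filter fun i => a ∈ B i

theorem mem_occ {B : ℕ → List ℕ} {m a i : ℕ} : i ∈ occ B m a ↔ i < m ∧ a ∈ B i := by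
  simp [occ]

theorem count_word {B : ℕ → List ℕ} {m : ℕ} (hB : ∀ i < m, (B i).Nodup) (a : ℕ) :
    (word B m).count a = (occ B m a).card := by
  induction m with
  | zero => simp [word, occ]
  | succ m ih =>
    have h : word B (m + 1) = word B m ++ B m := by
      simp [word, List.range_succ, List.flatMap_append]
    rw [h, List.count_append, ih fun i hi => hB i (by omega), occ, occ, Finset.range_add_one,
      Finset.filter_insert]
    by_cases ha : a ∈ B m
    · rw [if_pos ha, Finset.card_insert_of_notMem (by simp),
        List.count_eq_one_of_mem (hB m (by omega)) ha]
    · rw [if_neg ha, List.count_eq_zero_of_not_mem ha]; rfl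

/-- The sequence of the blocks `B 0, ..., B (m - 1)` has distinct letters in every block and no
alternation `ababa`, and every letter occurs in at least `k` blocks. -/
structure BlockAdm (k m : ℕ) (B : ℕ → List ℕ) : Prop where
  nodup : ∀ i < m, (B i).Nodup
  le_card : ∀ a ∈ word B m, k ≤ (occ B m a).card
  avoids : AvoidsAlternation 5 (word B m)

theorem BlockAdm.not_sublist {k m : ℕ} {B : ℕ → List ℕ} (h : BlockAdm k m B) {a b : ℕ}
    (hab : a ≠ b) : ¬ List.Sublist [a, b, a, b, a] (tailWord B m 0) := by
  rw [tailWord_zero]; exact h.avoids a b hab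

/-- A sequence on `m` blocks without alternation `ababa` in which every letter occurs at least `k`
times has at most `N` letters. -/
def LettersLE (k m N : ℕ) : Prop :=
  ∀ B : ℕ → List ℕ, BlockAdm k m B → (word B m).toFinset.card ≤ N

theorem LettersLE.mono {k k' m N N' : ℕ} (h : LettersLE k m N) (hk : k ≤ k') (hN : N ≤ N') :
    LettersLE k' m N' := fun B hB =>
  (h B ⟨hB.nodup, fun a ha => hk.trans (hB.le_card a ha), hB.avoids⟩).trans hN

/-- Pad with empty blocks. -/
theorem LettersLE.mono_blocks {k m m' N : ℕ} (h : LettersLE k m' N) (hm : m ≤ m') :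
    LettersLE k m N := by
  intro B hB
  set B' : ℕ → List ℕ := fun i => if i < m then B i else [] with hB'
  have hocc : ∀ a, occ B' m' a = occ B m a := by
    intro a
    ext i
    simp only [mem_occ, hB']
    by_cases hi : i < m
    · simp [hi, hi.trans_le hm]
    · simp [hi]
  have hw : word B' m' = word B m := by
    obtain ⟨e, rfl⟩ := Nat.exists_eq_add_of_le hm
    rw [word, List.range_add, List.flatMap_append, word]
    have h1 : (List.map (fun x => m + x) (List.range e)).flatMap B' = [] := by
      simp [List.flatMap_eq_nil_iff, hB']
    rw [h1, List.append_nil]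
    refine List.flatMap_congr fun i hi => ?_
    simp [hB', List.mem_range.1 hi]
  rw [← hw]
  refine h B' ⟨fun i _ => ?_, fun a ha => ?_, hw ▸ hB.avoids⟩
  · simp only [hB']
    split_ifs with hi
    · exact hB.nodup i hi
    · exact List.nodup_nil
  · rw [hocc]; exact hB.le_card a (hw ▸ ha)

theorem maxLetters_le {k m N : ℕ} (h : LettersLE k m N) : maxLetters 5 k m ≤ N := by
  refine iSup₂_le fun L hL => ?_
  set B : ℕ → List ℕ := fun i => L.getD i [] with hB
  have hw : word B m = L.flatten := by
    rw [word, List.flatMap_def]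
    congr 1
    refine List.ext_getElem (by simp [hL.length_eq]) fun i h1 h2 => ?_
    simp [hB, h2]
  have hnd : ∀ i < m, (B i).Nodup := by
    intro i hi
    have hi' : i < L.length := hL.length_eq ▸ hi
    simp only [hB, List.getD_eq_getElem L [] hi']
    exact hL.distinct _ (List.getElem_mem hi')
  rw [← hw]
  refine Nat.cast_le.2 (h B ⟨hnd, fun a ha => ?_, hw ▸ hL.avoids⟩)
  rw [← count_word hnd, hw]
  exact hL.occurrences a (hw ▸ ha)

/-! ### Charging letters to blocks -/

theorem card_le_of_injective_relation {S T : Finset ℕ} {P : ℕ → ℕ → Prop}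
    (h : ∀ a ∈ S, ∃ p ∈ T, P a p)
    (hinj : ∀ a ∈ S, ∀ b ∈ S, ∀ p, P a p → P b p → a = b) : S.card ≤ T.card := by
  classical
  choose! f hfT hfP using h
  refine Finset.card_le_card_of_injOn f hfT fun a ha b hb hab => ?_
  exact hinj a ha b hb (f a) (hfP a ha) (hab ▸ hfP b hb)

/-- A letter is charged to the pair of blocks of its second and third occurrences. If `a` and `b`
share the pair and come as `ab` in the first of the two blocks, then an earlier `b`, this `ab`, the
`a` of the second block and a later `b` form `babab`. -/
theorem lettersLE_four (m : ℕ) : LettersLE 4 m (m ^ 2) := by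
  classical
  intro B hB
  have key : ∀ a ∈ (word B m).toFinset, ∃ x ∈ Finset.range m ×ˢ Finset.range m,
      ∃ i l, i < x.1 ∧ x.1 < x.2 ∧ x.2 < l ∧ l < m ∧ a ∈ B i ∧ a ∈ B x.1 ∧ a ∈ B x.2 ∧ a ∈ B l := by
    intro a ha
    have hc := hB.le_card a (List.mem_toFinset.1 ha)
    set e := (occ B m a).orderEmbOfCardLe hc with he
    have hmem : ∀ x, e x < m ∧ a ∈ B (e x) := fun x =>
      mem_occ.1 (Finset.orderEmbOfCardLe_mem _ hc x)
    refine ⟨(e 1, e 2), by simp [hmem], e 0, e 3, ?_, ?_, ?_, (hmem 3).1, (hmem 0).2, (hmem 1).2,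
      (hmem 2).2, (hmem 3).2⟩ <;> exact e.strictMono (by decide)
  choose! f hf hP using key
  have hcard : (Finset.range m ×ˢ Finset.range m).card = m ^ 2 := by simp [sq]
  rw [← hcard]
  refine Finset.card_le_card_of_injOn f hf fun a ha b hb hab => ?_
  by_contra hne
  obtain ⟨i, l, h1, h2, h3, h4, ai, ap, aq, al⟩ := hP a ha
  obtain ⟨i', l', h1', -, h3', h4', bi, bp, bq, bl⟩ := hP b hb
  rw [← hab] at h1' h3' bp bq
  rcases pair_sublist_or hne ap bp with h | h
  · exact hB.not_sublist (Ne.symm hne) (cons_sublist_tailWord (Nat.zero_le i') (by omega) bi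
      (append_sublist_tailWord (u := [a, b]) (by omega) (by omega) h
        (cons_sublist_tailWord (by omega) (by omega) aq
          (cons_sublist_tailWord (by omega) h4' bl (List.nil_sublist _)))))
  · exact hB.not_sublist hne (cons_sublist_tailWord (Nat.zero_le i) (by omega) ai
      (append_sublist_tailWord (u := [b, a]) (by omega) (by omega) h
        (cons_sublist_tailWord (by omega) (by omega) bq
          (cons_sublist_tailWord (by omega) h4 al (List.nil_sublist _)))))

/-- The letter occurs before block `p`, in `p`, later in the group of `p`, and after that group. -/
def RepeatsBeforeLast (B : ℕ → List ℕ) (t m a p : ℕ) : Prop :=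
  a ∈ B p ∧ ∃ i j l, i < p ∧ p < j ∧ j / t = p / t ∧ p / t < l / t ∧ l < m ∧
    a ∈ B i ∧ a ∈ B j ∧ a ∈ B l

/-- The letter occurs before the group of block `p`, in that group before `p`, in `p`, and after
`p`. -/
def RepeatsAfterFirst (B : ℕ → List ℕ) (t m a p : ℕ) : Prop :=
  a ∈ B p ∧ ∃ i h j, i / t < p / t ∧ h < p ∧ h / t = p / t ∧ p < j ∧ j < m ∧
    a ∈ B i ∧ a ∈ B h ∧ a ∈ B j

theorem lt_of_div_lt {t x y : ℕ} (h : x / t < y / t) : x < y :=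
  lt_of_not_ge fun hle => absurd (Nat.div_le_div_right (c := t) hle) (not_le.2 h)

/-- If `p` contains `ab` in this order, then `b` before `p`, `ab` in `p`, `a` later in the group and
`b` after the group form `babab`. The group boundary guarantees that the last `b` follows the last
`a`. -/
theorem BlockAdm.repeatsBeforeLast_injective {k m t a b p : ℕ} {B : ℕ → List ℕ}
    (hB : BlockAdm k m B) (ha : RepeatsBeforeLast B t m a p) (hb : RepeatsBeforeLast B t m b p) :
    a = b := by
  by_contra hne
  obtain ⟨ap, i, j, l, hi, hj, hjt, hl, hlm, ai, aj, al⟩ := ha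
  obtain ⟨bp, i', j', l', hi', hj', hjt', hl', hlm', bi, bj, bl⟩ := hb
  have h1 : j < l' := lt_of_div_lt (t := t) (by omega)
  have h2 : j' < l := lt_of_div_lt (t := t) (by omega)
  rcases pair_sublist_or hne ap bp with h | h
  · exact hB.not_sublist (Ne.symm hne) (cons_sublist_tailWord (Nat.zero_le i') (by omega) bi
      (append_sublist_tailWord (u := [a, b]) (by omega) (by omega) h
        (cons_sublist_tailWord (by omega) (by omega) aj
          (cons_sublist_tailWord (by omega) hlm' bl (List.nil_sublist _)))))
  · exact hB.not_sublist hne (cons_sublist_tailWord (Nat.zero_le i) (by omega) ai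
      (append_sublist_tailWord (u := [b, a]) (by omega) (by omega) h
        (cons_sublist_tailWord (by omega) (by omega) bj
          (cons_sublist_tailWord (by omega) hlm al (List.nil_sublist _)))))

/-- The mirror image: `a` before the group, `b` in the group before `p`, `ab` in `p`, and `a` after
`p`. -/
theorem BlockAdm.repeatsAfterFirst_injective {k m t a b p : ℕ} {B : ℕ → List ℕ}
    (hB : BlockAdm k m B) (ha : RepeatsAfterFirst B t m a p) (hb : RepeatsAfterFirst B t m b p) :
    a = b := by
  by_contra hne
  obtain ⟨ap, i, h, j, hi, hh, hht, hj, hjm, ai, ah, aj⟩ := ha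
  obtain ⟨bp, i', h', j', hi', hh', hht', hj', hjm', bi, bh, bj⟩ := hb
  have h1 : i < h' := lt_of_div_lt (t := t) (by omega)
  have h2 : i' < h := lt_of_div_lt (t := t) (by omega)
  rcases pair_sublist_or hne ap bp with hs | hs
  · exact hB.not_sublist hne (cons_sublist_tailWord (Nat.zero_le i) (by omega) ai
      (cons_sublist_tailWord (by omega) (by omega) bh
      (append_sublist_tailWord (u := [a, b]) (by omega) (by omega) hs
          (cons_sublist_tailWord (by omega) hjm aj (List.nil_sublist _)))))
  · exact hB.not_sublist (Ne.symm hne) (cons_sublist_tailWord (Nat.zero_le i') (by omega) bi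
      (cons_sublist_tailWord (by omega) (by omega) ah
      (append_sublist_tailWord (u := [b, a]) (by omega) (by omega) hs
          (cons_sublist_tailWord (by omega) hjm' bj (List.nil_sublist _)))))

/-- A letter that occurs in several groups and repeats neither before its last nor after its first
group occurs at most twice in its first and in its last group and once in the others. -/
theorem card_occ_le {B : ℕ → List ℕ} {t m a i₀ i₁ : ℕ} (h₀ : i₀ ∈ occ B m a) (h₁ : i₁ ∈ occ B m a)
    (hne : i₀ / t ≠ i₁ / t) (hbefore : ∀ p, ¬ RepeatsBeforeLast B t m a p)
    (hafter : ∀ p, ¬ RepeatsAfterFirst B t m a p) :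
    (occ B m a).card ≤ ((occ B m a).image (· / t)).card + 2 := by
  classical
  obtain ⟨x, hx, hxmin⟩ := Finset.exists_min_image (occ B m a) (· / t) ⟨i₀, h₀⟩
  obtain ⟨y, hy, hymax⟩ := Finset.exists_max_image (occ B m a) (· / t) ⟨i₀, h₀⟩
  have hxy : x / t < y / t := by
    have a1 := hxmin _ h₀
    have a2 := hxmin _ h₁
    have a3 := hymax _ h₀
    have a4 := hymax _ h₁
    omega
  -- Three occurrences in the first group make the middle one a repetition before the last group.
  -- Three in the last group make the middle one a repetition after the first group. Two in any
  -- other group make the earlier one a repetition before the last group.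
  have hfib : ∀ g ∈ (occ B m a).image (· / t), ((occ B m a).filter fun i => i / t = g).card ≤
      1 + ((if g = x / t then 1 else 0) + if g = y / t then 1 else 0) := by
    intro g hg
    have hxm := mem_occ.1 hx
    have hym := mem_occ.1 hy
    by_contra hlt
    rw [not_le] at hlt
    have hmem : ∀ {i}, i ∈ (occ B m a).filter (fun i => i / t = g) →
        i < m ∧ a ∈ B i ∧ i / t = g := fun {i} hi => by
      obtain ⟨u, v⟩ := Finset.mem_filter.1 hi
      exact ⟨(mem_occ.1 u).1, (mem_occ.1 u).2, v⟩
    obtain ⟨z, hz, rfl⟩ := Finset.mem_image.1 hg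
    have hzx := hxmin z hz
    have hzy := hymax z hz
    by_cases hgx : z / t = x / t
    · have hc : 3 ≤ ((occ B m a).filter fun i => i / t = z / t).card := by
        rw [if_pos hgx] at hlt; omega
      set e := Finset.orderEmbOfCardLe _ hc with he
      have hE := fun n => hmem (Finset.orderEmbOfCardLe_mem _ hc n)
      have e01 : e 0 < e 1 := e.strictMono (by decide)
      have e12 : e 1 < e 2 := e.strictMono (by decide)
      have E0 := hE 0; have E1 := hE 1; have E2 := hE 2
      rw [← he] at E0 E1 E2
      exact hbefore (e 1) ⟨E1.2.1, e 0, e 2, y, e01, e12, by omega, by omega, hym.1,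
        E0.2.1, E2.2.1, hym.2⟩
    by_cases hgy : z / t = y / t
    · have hc : 3 ≤ ((occ B m a).filter fun i => i / t = z / t).card := by
        rw [if_pos hgy] at hlt; omega
      set e := Finset.orderEmbOfCardLe _ hc with he
      have hE := fun n => hmem (Finset.orderEmbOfCardLe_mem _ hc n)
      have e01 : e 0 < e 1 := e.strictMono (by decide)
      have e12 : e 1 < e 2 := e.strictMono (by decide)
      have E0 := hE 0; have E1 := hE 1; have E2 := hE 2
      rw [← he] at E0 E1 E2
      exact hafter (e 1) ⟨E1.2.1, x, e 0, e 2, by omega, e01, by omega, e12, E2.1,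
        hxm.2, E0.2.1, E2.2.1⟩
    · have hc : 2 ≤ ((occ B m a).filter fun i => i / t = z / t).card := by omega
      set e := Finset.orderEmbOfCardLe _ hc with he
      have hE := fun n => hmem (Finset.orderEmbOfCardLe_mem _ hc n)
      have e01 : e 0 < e 1 := e.strictMono (by decide)
      have E0 := hE 0; have E1 := hE 1
      rw [← he] at E0 E1
      exact hbefore (e 0) ⟨E0.2.1, x, e 1, y, lt_of_div_lt (t := t) (by omega), e01, by omega,
        by omega, hym.1, hxm.2, E1.2.1, hym.2⟩
  rw [Finset.card_eq_sum_card_image (· / t) (occ B m a)]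
  refine (Finset.sum_le_sum hfib).trans ?_
  rw [Finset.sum_add_distrib, Finset.sum_add_distrib, Finset.sum_const, smul_eq_mul, mul_one,
    Finset.sum_ite_eq', Finset.sum_ite_eq']
  split_ifs <;> omega

/-! ### Groups of blocks: local letters and contraction -/

theorem word_mul (B : ℕ → List ℕ) (b t : ℕ) :
    word B (b * t) = word (fun g => word (fun i => B (g * t + i)) t) b := by
  induction b with
  | zero => simp [word]
  | succ b ih =>
    rw [Nat.succ_mul, word, List.range_add, List.flatMap_append, ← word, ih, word, word,
      List.range_succ, List.flatMap_append, List.flatMap_map]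
    simp [word]

theorem word_sublist_word {B C : ℕ → List ℕ} {m : ℕ} (h : ∀ i < m, List.Sublist (C i) (B i)) :
    List.Sublist (word C m) (word B m) := by
  induction m with
  | zero => simp [word]
  | succ m ih =>
    simp only [word, List.range_succ, List.flatMap_append, List.flatMap_cons, List.flatMap_nil,
      List.append_nil]
    exact (ih fun i hi => h i (by omega)).append (h m (by omega))

theorem AvoidsAlternation.sublist {s : ℕ} {v w : List ℕ} (h : AvoidsAlternation s w)
    (hvw : List.Sublist v w) : AvoidsAlternation s v :=
  fun a b hab hs => h a b hab (hs.trans hvw)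

/-- The letters that occur in group `g` only. -/
def localLetters (B : ℕ → List ℕ) (t m g : ℕ) : Finset ℕ :=
  (word B m).toFinset.filter fun a => ∀ i ∈ occ B m a, i / t = g

/-- Restricting the blocks of the group to its local letters loses no occurrence of them, so the
restriction is admissible on `t` blocks. -/
theorem BlockAdm.card_localLetters_le {k b t N g : ℕ} {B : ℕ → List ℕ} (hB : BlockAdm k (b * t) B)
    (hN : LettersLE k t N) (hg : g < b) : (localLetters B t (b * t) g).card ≤ N := by
  classical
  rcases Nat.eq_zero_or_pos t with rfl | ht
  · simp [localLetters, word]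
  have hlt : ∀ i < t, g * t + i < b * t := fun i hi => by
    have : (g + 1) * t ≤ b * t := Nat.mul_le_mul_right t hg
    rw [Nat.succ_mul] at this; omega
  set L := localLetters B t (b * t) g with hL
  set C : ℕ → List ℕ := fun i => (B (g * t + i)).filter (· ∈ L) with hC
  have hsub : List.Sublist (word C t) (word B (b * t)) := by
    rw [word_mul]
    refine (word_sublist_word (B := fun i => B (g * t + i)) fun i _ => ?_).trans ?_
    · exact List.filter_sublist
    · rw [← tailWord_zero _ b, ← List.append_nil (word (fun i => B (g * t + i)) t)]
      exact append_sublist_tailWord (B := fun g => word (fun i => B (g * t + i)) t)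
        (Nat.zero_le g) hg (List.Sublist.refl _) (List.nil_sublist _)
  have himage : ∀ a ∈ L, occ B (b * t) a = (occ C t a).image (g * t + ·) := by
    intro a ha
    have ha' := (Finset.mem_filter.1 ha).2
    ext i
    simp only [Finset.mem_image]
    constructor
    · intro hi
      have hig := ha' i hi
      have := Nat.div_add_mod' i t
      rw [hig] at this
      refine ⟨i % t, mem_occ.2 ⟨Nat.mod_lt _ ht, ?_⟩, this⟩
      simp only [hC, List.mem_filter, this]
      exact ⟨(mem_occ.1 hi).2, by simpa using ha⟩
    · rintro ⟨j, hj, rfl⟩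
      obtain ⟨hj1, hj2⟩ := mem_occ.1 hj
      exact mem_occ.2 ⟨hlt j hj1, (List.mem_filter.1 hj2).1⟩
  have hadm : BlockAdm k t C := by
    refine ⟨fun i hi => (hB.nodup _ (hlt i hi)).filter _, fun a ha => ?_, hB.avoids.sublist hsub⟩
    obtain ⟨i, -, hai⟩ := mem_word.1 ha
    have haL : a ∈ L := by simpa using (List.mem_filter.1 hai).2
    have := hB.le_card a (hsub.subset ha)
    rw [himage a haL, Finset.card_image_of_injective _ (add_right_injective _)] at this
    exact this
  refine (Finset.card_le_card fun a ha => ?_).trans (hN C hadm)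
  have ha1 := List.mem_toFinset.1 (Finset.mem_filter.1 ha).1
  obtain ⟨i, hi, hai⟩ := mem_word.1 ha1
  have : i ∈ occ B (b * t) a := mem_occ.2 ⟨hi, hai⟩
  rw [himage a ha] at this
  obtain ⟨j, hj, -⟩ := Finset.mem_image.1 this
  exact List.mem_toFinset.2 (mem_word.2 ⟨j, mem_occ.1 hj⟩)

/-- The recurrence: the `b * t` blocks are divided into `b` groups of `t` blocks. -/
theorem LettersLE.mul {k b t N N' : ℕ} (hN : LettersLE (k + 2) t N) (hN' : LettersLE k b N') :
    LettersLE (k + 2) (b * t) (b * N + N' + 2 * (b * t)) := by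
  classical
  intro B hB
  rcases Nat.eq_zero_or_pos t with rfl | ht
  · simp [word]
  set m := b * t with hm
  set L := (word B m).toFinset with hL
  set Loc := (Finset.range b).biUnion (localLetters B t m) with hLoc
  set S₁ := L.filter fun a => ∃ p ∈ Finset.range m, RepeatsBeforeLast B t m a p with hS₁
  set S₂ := L.filter fun a => ∃ p ∈ Finset.range m, RepeatsAfterFirst B t m a p with hS₂
  set R := L.filter fun a => a ∉ Loc ∧ a ∉ S₁ ∧ a ∉ S₂ with hR
  -- Local letters contribute `b * N`, the two kinds of charged letters at most `m` each, and the
  -- remaining letters `R` survive the contraction.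
  have hcover : L ⊆ Loc ∪ R ∪ (S₁ ∪ S₂) := by
    intro a ha
    simp only [Finset.mem_union]
    by_cases h1 : a ∈ Loc
    · tauto
    by_cases h2 : a ∈ S₁
    · tauto
    by_cases h3 : a ∈ S₂
    · tauto
    exact Or.inl (Or.inr (Finset.mem_filter.2 ⟨ha, h1, h2, h3⟩))
  have c1 : Loc.card ≤ b * N := by
    refine (Finset.card_biUnion_le_card_mul _ _ N fun g hg => ?_).trans (by simp)
    exact hB.card_localLetters_le hN (Finset.mem_range.1 hg)
  have c2 : S₁.card ≤ m := by
    rw [← Finset.card_range m]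
    exact card_le_of_injective_relation (fun a ha => (Finset.mem_filter.1 ha).2)
      fun a _ b _ p => hB.repeatsBeforeLast_injective
  have c3 : S₂.card ≤ m := by
    rw [← Finset.card_range m]
    exact card_le_of_injective_relation (fun a ha => (Finset.mem_filter.1 ha).2)
      fun a _ b _ p => hB.repeatsAfterFirst_injective
  have c4 : R.card ≤ N' := by
    -- The contraction: removing duplicates from a group yields a legal block that is still a
    -- subsequence of the group, so no alternation is created.
    set C : ℕ → List ℕ := fun g => (word (fun i => B (g * t + i)) t).dedup.filter (· ∈ R) with hC
    have hsub : List.Sublist (word C b) (word B m) := by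
      rw [hm, word_mul]
      exact word_sublist_word fun g _ => List.filter_sublist.trans (List.dedup_sublist _)
    have himage : ∀ a ∈ R, (occ B m a).image (· / t) = occ C b a := by
      intro a ha
      ext g
      simp only [Finset.mem_image, mem_occ, hC, List.mem_filter, List.mem_dedup, mem_word]
      constructor
      · rintro ⟨i, ⟨hi, hai⟩, rfl⟩
        refine ⟨Nat.div_lt_of_lt_mul (by rwa [mul_comm]), ⟨i % t, Nat.mod_lt _ ht, ?_⟩,
          by simpa using ha⟩
        rwa [Nat.div_add_mod']
      · rintro ⟨hg, ⟨i, hi, hai⟩, -⟩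
        refine ⟨g * t + i, ⟨?_, hai⟩, ?_⟩
        · have : (g + 1) * t ≤ b * t := Nat.mul_le_mul_right t hg
          rw [Nat.succ_mul] at this; omega
        · rw [mul_comm, Nat.mul_add_div ht, Nat.div_eq_of_lt hi, add_zero]
    have hadm : BlockAdm k b C := by
      refine ⟨fun g _ => (List.nodup_dedup _).filter _, fun a ha => ?_, hB.avoids.sublist hsub⟩
      obtain ⟨g, -, hag⟩ := mem_word.1 ha
      have haR : a ∈ R := by simpa using (List.mem_filter.1 hag).2
      obtain ⟨haL, hloc, h1, h2⟩ := Finset.mem_filter.1 haR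
      have haW := List.mem_toFinset.1 haL
      obtain ⟨i₀, hi₀, ha₀⟩ := mem_word.1 haW
      have h₀ : i₀ ∈ occ B m a := mem_occ.2 ⟨hi₀, ha₀⟩
      have hglob : ∃ i₁ ∈ occ B m a, i₁ / t ≠ i₀ / t := by
        by_contra! hcon
        refine hloc (Finset.mem_biUnion.2 ⟨i₀ / t, Finset.mem_range.2 ?_,
          Finset.mem_filter.2 ⟨haL, hcon⟩⟩)
        exact Nat.div_lt_of_lt_mul (by rwa [mul_comm])
      obtain ⟨i₁, h₁, hne⟩ := hglob
      -- At least `k + 2` occurrences, at most two more than the number of groups met: at least `k`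
      -- groups remain.
      have hcard := card_occ_le h₁ h₀ hne
        (fun p hp => h1 (Finset.mem_filter.2 ⟨haL, p, Finset.mem_range.2 (by
          obtain ⟨-, i, j, l, hi, hj, hjt, hl, hlm, -⟩ := hp
          exact (lt_of_div_lt hl).trans hlm), hp⟩))
        (fun p hp => h2 (Finset.mem_filter.2 ⟨haL, p, Finset.mem_range.2 (by
          obtain ⟨-, i, h, j, hi, hh, hht, hj, hjm, -⟩ := hp
          exact hj.trans hjm), hp⟩))
      rw [himage a haR] at hcard
      have := hB.le_card a haW
      omega
    refine (Finset.card_le_card fun a ha => ?_).trans (hN' C hadm)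
    obtain ⟨i, hi, hai⟩ := mem_word.1 (List.mem_toFinset.1 (Finset.mem_filter.1 ha).1)
    have h₀ : i / t ∈ occ C b a := by
      rw [← himage a ha]
      exact Finset.mem_image_of_mem _ (mem_occ.2 ⟨hi, hai⟩)
    exact List.mem_toFinset.2 (mem_word.2 ⟨_, mem_occ.1 h₀⟩)
  have := Finset.card_le_card hcover
  have u1 := Finset.card_union_le (Loc ∪ R) (S₁ ∪ S₂)
  have u2 := Finset.card_union_le Loc R
  have u3 := Finset.card_union_le S₁ S₂
  omega

/-! ### The Ackermann hierarchy -/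

theorem hier_two (n : ℕ) : hier 2 n = 2 ^ n := by
  induction n with
  | zero => rfl
  | succ n ih => rw [hier_succ 0, ih, hier_one, pow_succ']

theorem hier_strictMono (k : ℕ) : StrictMono (hier (k + 1)) := by
  cases k with
  | zero => exact fun a b h => by simp only [zero_add, hier_one]; omega
  | succ k =>
    refine strictMono_nat_of_lt_succ fun n => ?_
    rw [hier_succ]
    refine lt_hier k _ ?_
    cases n with
    | zero => rw [hier_zero]
    | succ n => exact (Nat.zero_le _).trans_lt (lt_hier (k + 1) (n + 1) (by omega))

theorem hier_pos (k n : ℕ) : 1 ≤ hier (k + 2) n :=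
  (hier_zero k).symm.le.trans ((hier_strictMono (k + 1)).monotone (Nat.zero_le n))

/-- Powers of two make consecutive values divide each other, so the induction along the hierarchy
needs no rounding. -/
theorem exists_hier_eq_two_pow (k : ℕ) : ∀ n, ∃ e, hier (k + 2) n = 2 ^ e := by
  induction k with
  | zero => exact fun n => ⟨n, hier_two n⟩
  | succ k ih =>
    intro n
    cases n with
    | zero => exact ⟨0, hier_zero _⟩
    | succ n => rw [hier_succ]; exact ih _

theorem hier_dvd_hier_succ (k n : ℕ) : hier (k + 2) n ∣ hier (k + 2) (n + 1) := by
  obtain ⟨e, he⟩ := exists_hier_eq_two_pow k n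
  obtain ⟨e', he'⟩ := exists_hier_eq_two_pow k (n + 1)
  have h := (hier_strictMono (k + 1)).monotone (Nat.le_succ n)
  rw [Nat.succ_eq_add_one, he, he'] at h
  rw [he, he']
  exact Nat.pow_dvd_pow 2 ((Nat.pow_le_pow_iff_right (by omega)).1 h)

theorem invHier_le {k x n : ℕ} (h : x ≤ hier k n) : invHier k x ≤ n :=
  Nat.sInf_le h

theorem hier_lt_of_lt_invHier {k x n : ℕ} (h : n < invHier k x) : hier k n < x :=
  lt_of_not_ge fun hle => absurd (invHier_le hle) (not_le.2 h)

/-! ### Upper bounds from the recurrence -/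

/-- Rounding up to a multiple of `t` at most doubles `m`, since `t ≤ m`. -/
theorem exists_ceil_div {t m : ℕ} (ht : 1 ≤ t) (hm : t ≤ m) :
    ∃ b, m ≤ b * t ∧ b * t ≤ 2 * m ∧ b ≤ m ∧ ∀ s, m ≤ s * t → b ≤ s := by
  refine ⟨m ⌈/⌉ t, ?_, ?_, ?_, ?_⟩
  · rw [mul_comm]; simpa using le_smul_ceilDiv (α := ℕ) (β := ℕ) (a := t) (b := m) ht
  · rw [Nat.ceilDiv_eq_add_pred_div]
    have := Nat.div_mul_le_self (m + t - 1) t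
    omega
  · rw [ceilDiv_le_iff_le_mul ht]; nlinarith
  · intro s hs
    rw [ceilDiv_le_iff_le_mul ht]; linarith

/-- With `b = t` the contracted letters cost `t ^ 2` and the charged ones `2 * t ^ 2`, hence 3 more
letters per block at each squaring. -/
theorem lettersLE_six_two_pow_two_pow (n : ℕ) :
    LettersLE 6 (2 ^ 2 ^ n) (2 ^ 2 ^ n * (3 * n + 2)) := by
  induction n with
  | zero => exact (lettersLE_four 2).mono (by norm_num) (by norm_num)
  | succ n ih =>
    have h := LettersLE.mul (k := 4) ih (lettersLE_four (2 ^ 2 ^ n))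
    have h2 : 2 ^ 2 ^ (n + 1) = 2 ^ 2 ^ n * 2 ^ 2 ^ n := by rw [← pow_add]; congr 1; ring
    rw [h2]
    refine h.mono le_rfl (le_of_eq ?_)
    ring

/-- `A_{5,6}(m) = O(m log log m)`, with `n` in place of the iterated logarithm. -/
theorem lettersLE_six {m n : ℕ} (h : 2 ^ 2 ^ n ≤ m) (h' : m ≤ 2 ^ 2 ^ (n + 1)) :
    LettersLE 6 m (2 * m * (3 * n + 5)) := by
  obtain ⟨b, h1, h2, -, h3⟩ := exists_ceil_div (Nat.one_le_two_pow) h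
  -- One last round with `b ≤ t`, which is what makes the quadratic bound `b ^ 2` at most `b * t`.
  have hb : b ≤ 2 ^ 2 ^ n := h3 _ (h'.trans (le_of_eq (by rw [← pow_add]; congr 1; ring)))
  have hrec := LettersLE.mul (k := 4) (lettersLE_six_two_pow_two_pow n) (lettersLE_four b)
  refine (hrec.mono_blocks h1).mono le_rfl ?_
  generalize 2 ^ 2 ^ n = t at *
  have h4 : b ^ 2 ≤ b * t := by rw [sq]; exact Nat.mul_le_mul_left b hb
  calc b * (t * (3 * n + 2)) + b ^ 2 + 2 * (b * t)
      ≤ b * (t * (3 * n + 2)) + b * t + 2 * (b * t) := by gcongr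
    _ = (b * t) * (3 * n + 5) := by ring
    _ ≤ 2 * m * (3 * n + 5) := by gcongr

/-- A logarithm in place of the iterated logarithm. This loss is harmless: the next level only uses
that the factor is at most of order `t` when `b ≤ 2 ^ t`. -/
theorem lettersLE_six_invHier (m : ℕ) : LettersLE 6 m (10 * m * (invHier 2 m + 1)) := by
  have hm := le_hier_invHier 1 m
  rw [hier_two] at hm
  simp only [Nat.reduceAdd] at hm
  set i := invHier 2 m with hi
  by_cases h2 : m ≤ 2
  · refine (lettersLE_four m).mono (by norm_num) ?_
    rw [sq, mul_right_comm]
    exact Nat.mul_le_mul_right m (by omega)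
  have hex : ∃ n, m ≤ 2 ^ 2 ^ n :=
    ⟨i, hm.trans (Nat.pow_le_pow_right (by omega) Nat.lt_two_pow_self.le)⟩
  classical
  have hfi : Nat.find hex ≤ i :=
    Nat.find_min' hex (hm.trans (Nat.pow_le_pow_right (by omega) Nat.lt_two_pow_self.le))
  obtain ⟨n, hn⟩ : ∃ n, Nat.find hex = n + 1 := by
    refine Nat.exists_eq_succ_of_ne_zero fun h0 => h2 ?_
    have := Nat.find_spec hex
    rw [h0] at this
    simpa using this
  have hlow := Nat.find_min hex (m := n) (by omega)
  have hup := Nat.find_spec hex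
  rw [hn] at hup
  refine (lettersLE_six (not_le.1 hlow).le hup).mono le_rfl ?_
  have : 3 * n + 5 ≤ 5 * (i + 1) := by omega
  calc 2 * m * (3 * n + 5) ≤ 2 * m * (5 * (i + 1)) := by gcongr
    _ = 10 * m * (i + 1) := by ring

/-- The bound of the recurrence when the group size is large enough for the contracted sequence to
have linearly many letters. -/
theorem LettersLE.mul_of_invHier_le {k d C K b t : ℕ}
    (hk : ∀ m, LettersLE k m (C * m * (invHier (d + 2) m + 1)))
    (ht : LettersLE (k + 2) t (t * K)) (h1 : 1 ≤ t) (hb : invHier (d + 2) b ≤ t) :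
    LettersLE (k + 2) (b * t) (b * t * (K + (2 * C + 2))) := by
  refine (LettersLE.mul ht (hk b)).mono le_rfl ?_
  have : C * b * (invHier (d + 2) b + 1) ≤ C * b * (t + t) := by gcongr
  calc b * (t * K) + C * b * (invHier (d + 2) b + 1) + 2 * (b * t)
      ≤ b * (t * K) + C * b * (t + t) + 2 * (b * t) := by gcongr
    _ = b * t * (K + (2 * C + 2)) := by ring

theorem lettersLE_self_of_le_one {k m : ℕ} (hk : 4 ≤ k) (hm : m ≤ 1) : LettersLE k m m :=
  (lettersLE_four m).mono hk (by interval_cases m <;> norm_num)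

/-- Groups of size `t = A_{d+3}(n)` are combined into `A_{d+3}(n+1) = A_{d+2}(t)` blocks. Their
number `b` is at most `A_{d+2}(t)`, so `α_{d+2}(b) ≤ t` and each step adds only `2 * C + 2` letters
per block. -/
theorem lettersLE_hier {k d C : ℕ} (hk4 : 4 ≤ k)
    (hk : ∀ m, LettersLE k m (C * m * (invHier (d + 2) m + 1))) (n : ℕ) :
    LettersLE (k + 2) (hier (d + 3) n) (hier (d + 3) n * ((2 * C + 2) * n + 1)) := by
  induction n with
  | zero =>
    rw [hier_zero]
    exact (lettersLE_self_of_le_one (by omega) le_rfl).mono le_rfl (by norm_num)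
  | succ n ih =>
    obtain ⟨b, hb⟩ := hier_dvd_hier_succ (d + 1) n
    have hpos := hier_pos (d + 1) n
    have hinv : invHier (d + 2) b ≤ hier (d + 3) n := by
      refine invHier_le ?_
      rw [← hier_succ, hb]
      exact Nat.le_mul_of_pos_left _ hpos
    have := LettersLE.mul_of_invHier_le hk ih hpos hinv
    rw [hb, mul_comm (hier (d + 1 + 2) n) b]
    refine this.mono le_rfl (le_of_eq ?_)
    ring

/-- Let `n + 1 = α_{d+3}(m)`. One final step with groups of size `A_{d+3}(n) < m` reaches `m`, and
rounding up doubles the bound. -/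
theorem lettersLE_invHier_succ {k d C : ℕ} (hk4 : 4 ≤ k)
    (hk : ∀ m, LettersLE k m (C * m * (invHier (d + 2) m + 1))) (m : ℕ) :
    LettersLE (k + 2) m ((4 * C + 5) * m * (invHier (d + 3) m + 1)) := by
  rcases Nat.eq_zero_or_pos (invHier (d + 3) m) with h0 | hpos
  · have hm := le_hier_invHier (d + 2) m
    rw [h0, hier_zero] at hm
    refine (lettersLE_self_of_le_one (by omega) hm).mono le_rfl ?_
    rw [h0]
    nlinarith
  · obtain ⟨n, hn⟩ := Nat.exists_eq_succ_of_ne_zero hpos.ne'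
    have hup := le_hier_invHier (d + 2) m
    rw [hn, Nat.succ_eq_add_one, hier_succ (d + 1)] at hup
    have hlow : hier (d + 3) n < m := hier_lt_of_lt_invHier (by omega)
    obtain ⟨b, h1, h2, h3, -⟩ := exists_ceil_div (hier_pos (d + 1) n) hlow.le
    have := LettersLE.mul_of_invHier_le hk (lettersLE_hier hk4 hk n) (hier_pos (d + 1) n)
      (b := b) (invHier_le (h3.trans hup))
    refine (this.mono_blocks h1).mono le_rfl ?_
    rw [hn]
    calc b * hier (d + 3) n * ((2 * C + 2) * n + 1 + (2 * C + 2))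
        ≤ 2 * m * ((2 * C + 2) * n + 1 + (2 * C + 2)) := by gcongr
      _ ≤ (4 * C + 5) * m * (n.succ + 1) := by
        rw [Nat.succ_eq_add_one]; nlinarith [Nat.zero_le (m * n)]

theorem exists_lettersLE_invHier (d : ℕ) :
    ∃ C, ∀ m, LettersLE (2 * d + 6) m (C * m * (invHier (d + 2) m + 1)) := by
  induction d with
  | zero => exact ⟨10, lettersLE_six_invHier⟩
  | succ d ih =>
    obtain ⟨C, hC⟩ := ih
    exact ⟨4 * C + 5, lettersLE_invHier_succ (by omega) hC⟩

theorem maxLetters_toENNReal_le {k m N : ℕ} {x : ℝ} (h : LettersLE k m N) (hx : (N : ℝ) ≤ x) :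
    (maxLetters 5 k m : ℝ≥0∞) ≤ ENNReal.ofReal x := by
  have h1 : (maxLetters 5 k m : ℝ≥0∞) ≤ ((N : ℕ∞) : ℝ≥0∞) :=
    ENat.toENNReal_le.2 (maxLetters_le h)
  refine h1.trans ?_
  rw [ENat.toENNReal_coe, ← ENNReal.ofReal_natCast]
  exact ENNReal.ofReal_le_ofReal hx

theorem maxLetters_upper (d : ℕ) (hd : 2 ≤ d) : ∃ C : ℝ, 0 < C ∧ ∀ᶠ m : ℕ in atTop,
    (maxLetters 5 (2 * d + 2) m : ℝ≥0∞) ≤ ENNReal.ofReal (C * (m * invHier d m)) := by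
  obtain ⟨e, rfl⟩ := Nat.exists_eq_add_of_le' hd
  obtain ⟨C, hC⟩ := exists_lettersLE_invHier e
  refine ⟨2 * C + 1, by positivity, ?_⟩
  filter_upwards [eventually_ge_atTop 2] with m hm
  have h1 : 1 ≤ invHier (e + 2) m := by
    by_contra h0
    have := le_hier_invHier (e + 1) m
    have h00 : invHier (e + 2) m = 0 := by omega
    rw [show e + 1 + 1 = e + 2 from rfl, h00, hier_zero e] at this
    omega
  refine maxLetters_toENNReal_le (hC m) ?_
  have h2 : C * m * (invHier (e + 2) m + 1) ≤ (2 * C + 1) * (m * invHier (e + 2) m) := by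
    calc C * m * (invHier (e + 2) m + 1) ≤ C * m * (invHier (e + 2) m + invHier (e + 2) m) := by
          gcongr
      _ ≤ (2 * C + 1) * (m * invHier (e + 2) m) := by nlinarith [Nat.zero_le (m * invHier (e + 2) m)]
  exact_mod_cast h2

theorem maxLetters_six_upper : ∃ C : ℝ, 0 < C ∧ ∀ᶠ m : ℕ in atTop,
    (maxLetters 5 6 m : ℝ≥0∞) ≤ ENNReal.ofReal (C * (m * Real.log (Real.log m))) := by
  refine ⟨34, by norm_num, ?_⟩
  have hll : Tendsto (fun m : ℕ => Real.log (Real.log m)) atTop atTop :=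
    Real.tendsto_log_atTop.comp (Real.tendsto_log_atTop.comp tendsto_natCast_atTop_atTop)
  filter_upwards [eventually_ge_atTop 4, hll.eventually_ge_atTop 1] with m hm hlog
  classical
  have hex : ∃ n, m ≤ 2 ^ 2 ^ n :=
    ⟨m, Nat.lt_two_pow_self.le.trans (Nat.pow_le_pow_right (by omega) Nat.lt_two_pow_self.le)⟩
  obtain ⟨n, hn⟩ : ∃ n, Nat.find hex = n + 1 := by
    refine Nat.exists_eq_succ_of_ne_zero fun h0 => ?_
    have := Nat.find_spec hex
    rw [h0] at this
    norm_num at this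
    omega
  have hlow := not_le.1 (Nat.find_min hex (m := n) (by omega))
  have hup := Nat.find_spec hex
  rw [hn] at hup
  refine maxLetters_toENNReal_le (lettersLE_six hlow.le hup) ?_
  have hlow' : (2 : ℝ) ^ 2 ^ n ≤ m := by exact_mod_cast hlow.le
  have h1 : (2 : ℝ) ^ n * Real.log 2 ≤ Real.log m := by
    have := Real.log_le_log (by positivity) hlow'
    rw [Real.log_pow] at this
    exact_mod_cast this
  have hl2 : (1 / 2 : ℝ) < Real.log 2 := by linarith [Real.log_two_gt_d9]
  have h2 : (2 : ℝ) ^ n * (1 / 2) ≤ Real.log m :=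
    (mul_le_mul_of_nonneg_left hl2.le (by positivity)).trans h1
  have h3 := Real.log_le_log (by positivity) h2
  rw [Real.log_mul (by positivity) (by norm_num), Real.log_pow, one_div, Real.log_inv] at h3
  have hl2' : Real.log 2 < 1 := by linarith [Real.log_two_lt_d9]
  have h4 : (n : ℝ) * (1 / 2) ≤ n * Real.log 2 :=
    mul_le_mul_of_nonneg_left hl2.le (Nat.cast_nonneg n)
  -- Here `n ≤ 2 * log log m + 2` gives `3 * n + 5 ≤ 6 * log log m + 11`, and `log log m ≥ 1`
  -- absorbs the 11. The factor 2 of `lettersLE_six` turns 17 into 34.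
  have h5 : (3 * n + 5 : ℝ) ≤ 17 * Real.log (Real.log m) := by linarith
  push_cast
  have hm0 : (0 : ℝ) ≤ m := Nat.cast_nonneg m
  nlinarith [mul_le_mul_of_nonneg_left h5 hm0]

/-! ### Alternations -/

/-- An alternation of `a` and `b` in a concatenation of words each of which misses one of the two
letters is at most as long as the number of these words. -/
theorem le_length_of_alternation_sublist {L : List (List ℕ)} :
    ∀ {s a b : ℕ}, (∀ u ∈ L, a ∉ u ∨ b ∉ u) → List.Sublist (alternation a b s) L.flatten →
      s ≤ L.length := by
  induction L with
  | nil =>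
    intro s a b _ h
    cases s with
    | zero => simp
    | succ s => simp [alternation] at h
  | cons u L ih =>
    intro s a b hL h
    rw [List.flatten_cons, List.sublist_append_iff] at h
    obtain ⟨l₁, l₂, heq, h₁, h₂⟩ := h
    match s, l₁ with
    | 0, _ => simp
    | s + 1, [] =>
      rw [List.nil_append] at heq
      rw [← heq] at h₂
      have := ih (fun v hv => hL v (List.mem_cons_of_mem _ hv)) h₂
      simp only [List.length_cons]; omega
    | s + 1, [x] =>
      simp only [alternation, List.cons_append, List.nil_append, List.cons.injEq] at heq
      rw [← heq.2] at h₂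
      have := ih (fun v hv => (hL v (List.mem_cons_of_mem _ hv)).symm) h₂
      simp only [List.length_cons]; omega
    | 1, x :: y :: l₁ => simp [alternation] at heq
    -- Two letters of the alternation taken from one word would be both `a` and `b`, so each word
    -- supplies at most one.
    | s + 2, x :: y :: l₁ =>
      simp only [alternation, List.cons_append, List.cons.injEq] at heq
      obtain ⟨rfl, rfl, -⟩ := heq
      have ha : a ∈ u := h₁.subset (by simp)
      have hb : b ∈ u := h₁.subset (by simp)
      have := hL u List.mem_cons_self
      tauto

theorem not_alternation_sublist {L : List (List ℕ)} {w : List ℕ} {a b : ℕ} (hw : w = L.flatten)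
    (hL : ∀ u ∈ L, a ∉ u ∨ b ∉ u) (hlen : L.length ≤ 4) :
    ¬ List.Sublist (alternation a b 5) w := fun h => by
  have := le_length_of_alternation_sublist hL (hw ▸ h)
  omega

theorem mem_of_alternation_sublist {w : List ℕ} {a b : ℕ}
    (h : List.Sublist (alternation a b 5) w) : a ∈ w ∧ b ∈ w :=
  ⟨h.subset (by simp [alternation]), h.subset (by simp [alternation])⟩

theorem isChain_alternation {a b : ℕ} (hab : a ≠ b) : (alternation a b 5).IsChain (· ≠ ·) := by
  simp [alternation, hab, hab.symm]

theorem AvoidsAlternation.map {w : List ℕ} {f : ℕ → ℕ} (hf : Function.Injective f)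
    (hw : AvoidsAlternation 5 w) : AvoidsAlternation 5 (w.map f) := by
  intro a b hab h
  obtain ⟨l, hl, heq⟩ := List.sublist_map_iff.1 h
  match l with
  | [x₁, x₂, x₃, x₄, x₅] =>
    simp only [alternation, List.map_cons, List.map_nil, List.cons.injEq, and_true] at heq
    obtain ⟨h1, h2, h3, h4, h5⟩ := heq
    have e3 : x₃ = x₁ := hf (h3.symm.trans h1)
    have e4 : x₄ = x₂ := hf (h4.symm.trans h2)
    have e5 : x₅ = x₁ := hf (h5.symm.trans h1)
    subst e3 e4 e5
    exact hw x₅ x₄ (fun h => hab (by rw [h1, h2, h])) hl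
  | [] | [_] | [_, _] | [_, _, _] | [_, _, _, _] | _ :: _ :: _ :: _ :: _ :: _ :: _ =>
    simp [alternation] at heq

/-- Every subsequence of `w'` without equal neighbours is a subsequence of `w`. -/
def Collapses (w' w : List ℕ) : Prop :=
  ∀ l : List ℕ, l.IsChain (· ≠ ·) → List.Sublist l w' → List.Sublist l w

theorem Collapses.refl (w : List ℕ) : Collapses w w := fun _ _ h => h

theorem Collapses.append {v v' w w' : List ℕ} (hv : Collapses v' v) (hw : Collapses w' w) :
    Collapses (v' ++ w') (v ++ w) := by
  intro l hl h
  obtain ⟨l₁, l₂, rfl, h₁, h₂⟩ := List.sublist_append_iff.1 h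
  obtain ⟨c₁, c₂, -⟩ := List.isChain_append.1 hl
  exact (hv l₁ c₁ h₁).append (hw l₂ c₂ h₂)

theorem collapses_pair (a : ℕ) : Collapses [a, a] [a] := by
  intro l hl h
  match l with
  | [] => simp
  | [x] => simpa using h
  | x :: y :: l =>
    have hx : x = a := by simpa using h.subset (List.mem_cons_self (a := x))
    have hy : y = a := by simpa using h.subset (List.mem_cons_of_mem x (List.mem_cons_self (a := y)))
    rw [List.isChain_cons_cons] at hl
    exact absurd (hx.trans hy.symm) hl.1

/-- An alternation has no equal neighbours, so it uses at most one letter of an inserted pair. -/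
theorem collapses_flatMap_pair (w : List ℕ) : Collapses (w.flatMap fun a => [a, a]) w := by
  induction w with
  | nil => exact Collapses.refl _
  | cons a w ih =>
    rw [List.flatMap_cons]
    exact (collapses_pair a).append ih

/-! ### Texts and profiles of lists of segments -/

/-- The word of a list of segments. -/
def text (X : List Segment) : List ℕ := (blocks X).flatten

@[simp] theorem blocks_nil : blocks [] = [] := rfl

@[simp] theorem blocks_plain (b : List ℕ) (X : List Segment) :
    blocks (.plain b :: X) = b :: blocks X := rfl

@[simp] theorem blocks_triple (l s r : List ℕ) (X : List Segment) :
    blocks (.triple l s r :: X) = l :: s :: r :: blocks X := rfl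

@[simp] theorem blocks_append (X Y : List Segment) : blocks (X ++ Y) = blocks X ++ blocks Y := by
  simp [blocks]

@[simp] theorem text_nil : text [] = [] := rfl

@[simp] theorem text_plain (b : List ℕ) (X : List Segment) :
    text (.plain b :: X) = b ++ text X := by simp [text]

@[simp] theorem text_triple (l s r : List ℕ) (X : List Segment) :
    text (.triple l s r :: X) = l ++ (s ++ (r ++ text X)) := by simp [text]

@[simp] theorem text_append (X Y : List Segment) : text (X ++ Y) = text X ++ text Y := by
  simp [text]

@[simp] theorem numSpecial_append (X Y : List Segment) :
    numSpecial (X ++ Y) = numSpecial X + numSpecial Y := by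
  induction X with
  | nil => simp [numSpecial]
  | cons S X ih => cases S <;> simp [numSpecial, ih]; omega

/-- The occurrences of the letter `a`, in order; `true` marks those in special blocks. -/
def profile (a : ℕ) : List Segment → List Bool
  | [] => []
  | .plain b :: X => List.replicate (b.count a) false ++ profile a X
  | .triple l s r :: X => List.replicate (l.count a) false ++ (List.replicate (s.count a) true ++
      (List.replicate (r.count a) false ++ profile a X))

theorem profile_append (a : ℕ) (X Y : List Segment) :
    profile a (X ++ Y) = profile a X ++ profile a Y := by
  induction X with
  | nil => simp [profile]
  | cons S X ih => cases S <;> simp [profile, ih]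

theorem length_profile (a : ℕ) (X : List Segment) :
    (profile a X).length = (text X).count a := by
  induction X with
  | nil => simp [profile]
  | cons S X ih => cases S <;> simp [profile, ih]

theorem profile_eq_nil_iff {a : ℕ} {X : List Segment} : profile a X = [] ↔ a ∉ text X := by
  rw [← List.length_eq_zero_iff, length_profile, List.count_eq_zero]

/-- The blocks have distinct letters, there is no alternation `ababa`, every letter occurs `2d + 2`
times, of which exactly the first and the last one are in special blocks, and the special blocks
have `m` letters. -/
structure Good (d m : ℕ) (X : List Segment) : Prop where
  distinct : DistinctInBlocks (blocks X)
  profile : ∀ a, profile a X = [] ∨ profile a X = true :: (List.replicate (2 * d) false ++ [true])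
  avoids : AvoidsAlternation 5 (text X)
  length_special : ∀ l s r, Segment.triple l s r ∈ X → s.length = m

theorem blocks_map_rename (f : ℕ → ℕ) (X : List Segment) :
    blocks (X.map (Segment.rename f)) = (blocks X).map (List.map f) := by
  induction X with
  | nil => rfl
  | cons S X ih => cases S <;> simp [Segment.rename, ih]

theorem text_map_rename (f : ℕ → ℕ) (X : List Segment) :
    text (X.map (Segment.rename f)) = (text X).map f := by
  rw [text, blocks_map_rename, text, List.map_flatten]

theorem numSpecial_map_rename (f : ℕ → ℕ) (X : List Segment) :
    numSpecial (X.map (Segment.rename f)) = numSpecial X := by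
  induction X with
  | nil => rfl
  | cons S X ih => cases S <;> simp [Segment.rename, numSpecial, ih]

theorem profile_map_rename {f : ℕ → ℕ} (hf : Function.Injective f) (a : ℕ) (X : List Segment) :
    profile (f a) (X.map (Segment.rename f)) = profile a X := by
  induction X with
  | nil => rfl
  | cons S X ih =>
    cases S <;> simp [Segment.rename, profile, ih, List.count_map_of_injective _ f hf]

theorem Good.rename {d m : ℕ} {X : List Segment} {f : ℕ → ℕ} (hf : Function.Injective f)
    (h : Good d m X) : Good d m (X.map (Segment.rename f)) where
  distinct := by
    intro b hb
    rw [blocks_map_rename, List.mem_map] at hb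
    obtain ⟨c, hc, rfl⟩ := hb
    exact (h.distinct c hc).map hf
  profile := by
    intro a
    by_cases ha : ∃ x, f x = a
    · obtain ⟨x, rfl⟩ := ha
      rw [profile_map_rename hf]
      exact h.profile x
    · left
      rw [profile_eq_nil_iff, text_map_rename, List.mem_map]
      rintro ⟨x, -, hx⟩
      exact ha ⟨x, hx⟩
  avoids := by
    rw [text_map_rename]
    exact h.avoids.map hf
  length_special := by
    intro l s r hs
    obtain ⟨S, hS, heq⟩ := List.mem_map.1 hs
    cases S with
    | plain b => simp [Segment.rename] at heq
    | triple l' s' r' =>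
      simp only [Segment.rename, Segment.triple.injEq] at heq
      rw [← heq.2.1, List.length_map]
      exact h.length_special _ _ _ hS

/-! ### Insertion of pairs -/

@[simp] theorem insertPairs_segments_nil (seen A : List ℕ) : insertPairs seen A [] = [] := by
  simp [insertPairs]

@[simp] theorem insertPairs_nil (seen : List ℕ) (X : List Segment) :
    insertPairs seen [] X = X := by
  cases X <;> simp [insertPairs]

theorem insertPairs_plain (seen A b : List ℕ) (X : List Segment) :
    insertPairs seen A (.plain b :: X) = .plain b :: insertPairs seen A X := by
  cases A <;> simp [insertPairs]

theorem insertPairs_triple (seen A l s r : List ℕ) (a : ℕ) (X : List Segment) :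
    insertPairs seen (a :: A) (.triple l s r :: X) =
      (if a ∈ seen then .triple (l ++ [a]) (a :: s) r else .triple l (s ++ [a]) (a :: r)) ::
        insertPairs seen A X := rfl

/-- Induction along the recursion of `insertPairs`. -/
theorem insertPairs_induction {P : List ℕ → List Segment → Prop} (h0 : ∀ A, P A [])
    (h1 : ∀ X, P [] X) (h2 : ∀ A b X, P A X → P A (.plain b :: X))
    (h3 : ∀ a A l s r X, P A X → P (a :: A) (.triple l s r :: X)) (A : List ℕ)
    (X : List Segment) : P A X := by
  induction X generalizing A with
  | nil => exact h0 A
  | cons S X ih =>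
    cases S with
    | plain b => exact h2 _ _ _ (ih A)
    | triple l s r =>
      cases A with
      | nil => exact h1 _
      | cons a A => exact h3 _ _ _ _ _ _ (ih A)

theorem numSpecial_insertPairs (seen A : List ℕ) (X : List Segment) :
    numSpecial (insertPairs seen A X) = numSpecial X := by
  induction A, X using insertPairs_induction with
  | h0 A => simp
  | h1 X => simp
  | h2 A b X ih => simpa [insertPairs_plain, numSpecial] using ih
  | h3 a A l s r X ih => rw [insertPairs_triple]; split_ifs <;> simpa [numSpecial] using ih

theorem length_blocks_insertPairs (seen A : List ℕ) (X : List Segment) :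
    (blocks (insertPairs seen A X)).length = (blocks X).length := by
  induction A, X using insertPairs_induction with
  | h0 A => simp
  | h1 X => simp
  | h2 A b X ih => simpa [insertPairs_plain] using ih
  | h3 a A l s r X ih => rw [insertPairs_triple]; split_ifs <;> simpa using ih

theorem mem_text_insertPairs {seen A : List ℕ} {X : List Segment} {x : ℕ}
    (h : x ∈ text (insertPairs seen A X)) : x ∈ A ∨ x ∈ text X := by
  induction A, X using insertPairs_induction with
  | h0 A => simp at h
  | h1 X => simpa using h
  | h2 A b X ih =>
    simp only [insertPairs_plain, text_plain, List.mem_append] at h ⊢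
    tauto
  | h3 a A l s r X ih =>
    rw [insertPairs_triple] at h
    split_ifs at h <;> simp only [text_triple, List.mem_append, List.mem_cons,
      List.not_mem_nil, or_false] at h ⊢ <;> tauto

theorem distinctInBlocks_insertPairs {seen A : List ℕ} {X : List Segment}
    (hX : DistinctInBlocks (blocks X)) (hA : ∀ a ∈ A, a ∉ text X) :
    DistinctInBlocks (blocks (insertPairs seen A X)) := by
  induction A, X using insertPairs_induction with
  | h0 A => simpa using hX
  | h1 X => simpa using hX
  | h2 A b X ih =>
    simp only [DistinctInBlocks, insertPairs_plain, blocks_plain, List.forall_mem_cons] at hX ih ⊢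
    exact ⟨hX.1, ih hX.2 fun a ha h => hA a ha (by simp [h])⟩
  | h3 a A l s r X ih =>
    have ha := hA a (by simp)
    simp only [text_triple, List.mem_append, not_or] at ha
    rw [insertPairs_triple]
    simp only [DistinctInBlocks, blocks_triple, List.forall_mem_cons] at hX ih
    obtain ⟨hl, hs, hr, hX⟩ := hX
    have ih' := ih hX fun a ha h => hA a (List.mem_cons_of_mem _ ha) (by simp [h])
    split_ifs <;> simp only [DistinctInBlocks, blocks_triple, List.forall_mem_cons]
    · refine ⟨?_, List.nodup_cons.2 ⟨ha.2.1, hs⟩, hr, ih'⟩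
      rw [← List.concat_eq_append]
      exact List.Nodup.concat ha.1 hl
    · refine ⟨hl, ?_, List.nodup_cons.2 ⟨ha.2.2.1, hr⟩, ih'⟩
      rw [← List.concat_eq_append]
      exact List.Nodup.concat ha.2.1 hs

theorem profile_insertPairs_of_notMem {seen A : List ℕ} {X : List Segment} {x : ℕ} (hx : x ∉ A) :
    profile x (insertPairs seen A X) = profile x X := by
  induction A, X using insertPairs_induction with
  | h0 A => simp
  | h1 X => simp
  | h2 A b X ih => simp [insertPairs_plain, profile, ih hx]
  | h3 a A l s r X ih =>
    rw [insertPairs_triple]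
    have h1 : a ≠ x := fun h => hx (by simp [h])
    have h2 := ih fun h => hx (by simp [h])
    split_ifs <;> simp [profile, h1, h2]

/-- The bound on `A.length` matters because `insertPairs` drops letters for which no special block
is left. -/
theorem profile_insertPairs_of_mem {seen A : List ℕ} {X : List Segment} {x : ℕ} (hx : x ∈ A)
    (hA : A.Nodup) (hxX : x ∉ text X) (hlen : A.length ≤ numSpecial X) :
    profile x (insertPairs seen A X) = if x ∈ seen then [false, true] else [true, false] := by
  induction A, X using insertPairs_induction with
  | h0 A =>
    simp only [numSpecial, nonpos_iff_eq_zero, List.length_eq_zero_iff] at hlen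
    simp [hlen] at hx
  | h1 X => simp at hx
  | h2 A b X ih =>
    simp only [text_plain, List.mem_append, not_or] at hxX
    simp [insertPairs_plain, profile, ih hx hA hxX.2 hlen, List.count_eq_zero_of_not_mem hxX.1]
  | h3 a A l s r X ih =>
    simp only [text_triple, List.mem_append, not_or] at hxX
    obtain ⟨h1, h2, h3, h4⟩ := hxX
    rw [List.nodup_cons] at hA
    simp only [numSpecial, List.length_cons, add_le_add_iff_right] at hlen
    have c1 := List.count_eq_zero_of_not_mem h1
    have c2 := List.count_eq_zero_of_not_mem h2
    have c3 := List.count_eq_zero_of_not_mem h3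
    rw [insertPairs_triple]
    rcases List.mem_cons.1 hx with rfl | hxA
    · have h5 : profile x (insertPairs seen A X) = [] := by
        rw [profile_insertPairs_of_notMem hA.1, profile_eq_nil_iff.2 h4]
      split_ifs <;> simp [profile, c1, c2, c3, h5]
    · have hne : a ≠ x := fun h => hA.1 (h ▸ hxA)
      rw [← ih hxA hA.2 h4 hlen]
      split_ifs <;> simp [profile, c1, c2, c3, hne]

theorem filter_text_insertPairs_of_false {seen A : List ℕ} {X : List Segment} {p : ℕ → Bool}
    (hA : ∀ a ∈ A, p a = false) :
    (text (insertPairs seen A X)).filter p = (text X).filter p := by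
  induction A, X using insertPairs_induction with
  | h0 A => simp
  | h1 X => simp
  | h2 A b X ih => simp [insertPairs_plain, ih hA]
  | h3 a A l s r X ih =>
    rw [insertPairs_triple]
    have h1 := hA a (by simp)
    have h2 := ih fun b hb => hA b (by simp [hb])
    split_ifs <;> simp [h1, h2]

theorem filter_text_insertPairs_of_true {seen A : List ℕ} {X : List Segment} {p : ℕ → Bool}
    (hA : ∀ a ∈ A, p a = true) (hX : ∀ x ∈ text X, p x = false)
    (hlen : A.length ≤ numSpecial X) :
    (text (insertPairs seen A X)).filter p = A.flatMap fun a => [a, a] := by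
  induction A, X using insertPairs_induction with
  | h0 A =>
    simp only [numSpecial, nonpos_iff_eq_zero, List.length_eq_zero_iff] at hlen
    simp [hlen]
  | h1 X => simpa using hX
  | h2 A b X ih =>
    simp only [text_plain, List.mem_append] at hX
    have h1 : b.filter p = [] := by
      simp only [List.filter_eq_nil_iff]; intro x hx; simp [hX x (Or.inl hx)]
    simp [insertPairs_plain, h1, ih hA (fun x hx => hX x (Or.inr hx)) hlen]
  | h3 a A l s r X ih =>
    simp only [text_triple, List.mem_append] at hX
    simp only [numSpecial, List.length_cons, add_le_add_iff_right] at hlen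
    have h1 : l.filter p = [] := by
      simp only [List.filter_eq_nil_iff]; intro x hx; simp [hX x (by tauto)]
    have h2 : s.filter p = [] := by
      simp only [List.filter_eq_nil_iff]; intro x hx; simp [hX x (by tauto)]
    have h3 : r.filter p = [] := by
      simp only [List.filter_eq_nil_iff]; intro x hx; simp [hX x (by tauto)]
    have h4 := ih (fun b hb => hA b (by simp [hb])) (fun x hx => hX x (by tauto)) hlen
    have h5 := hA a (by simp)
    rw [insertPairs_triple]
    split_ifs <;> simp [h1, h2, h3, h4, h5]

/-- The two inserted copies are adjacent in the word, although they lie in different blocks. So they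
form a single run. -/
theorem exists_text_insertPairs_eq {seen A : List ℕ} {X : List Segment} {x : ℕ} (hx : x ∈ A)
    (hA : A.Nodup) (hxX : x ∉ text X) (hlen : A.length ≤ numSpecial X) :
    ∃ P Q, text (insertPairs seen A X) = P ++ ([x, x] ++ Q) ∧ x ∉ P ∧ x ∉ Q := by
  induction A, X using insertPairs_induction with
  | h0 A =>
    simp only [numSpecial, nonpos_iff_eq_zero, List.length_eq_zero_iff] at hlen
    simp [hlen] at hx
  | h1 X => simp at hx
  | h2 A b X ih =>
    simp only [text_plain, List.mem_append, not_or] at hxX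
    obtain ⟨P, Q, h, hP, hQ⟩ := ih hx hA hxX.2 hlen
    exact ⟨b ++ P, Q, by simp [insertPairs_plain, h], by simp [hxX.1, hP], hQ⟩
  | h3 a A l s r X ih =>
    simp only [text_triple, List.mem_append, not_or] at hxX
    obtain ⟨h1, h2, h3, h4⟩ := hxX
    rw [List.nodup_cons] at hA
    simp only [numSpecial, List.length_cons, add_le_add_iff_right] at hlen
    rw [insertPairs_triple]
    rcases List.mem_cons.1 hx with rfl | hxA
    · have h5 : x ∉ text (insertPairs seen A X) := fun h =>
        (mem_text_insertPairs h).elim hA.1 h4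
      split_ifs
      · exact ⟨l, s ++ (r ++ text (insertPairs seen A X)), by simp, h1, by simp [h2, h3, h5]⟩
      · exact ⟨l ++ s, r ++ text (insertPairs seen A X), by simp, by simp [h1, h2],
          by simp [h3, h5]⟩
    · have hne : x ≠ a := fun h => hA.1 (h ▸ hxA)
      obtain ⟨P, Q, h, hP, hQ⟩ := ih hxA hA.2 h4 hlen
      split_ifs
      · exact ⟨l ++ (a :: a :: (s ++ (r ++ P))), Q, by simp [h], by simp [h1, h2, h3, hne, hP], hQ⟩
      · exact ⟨l ++ (s ++ (a :: a :: (r ++ P))), Q, by simp [h], by simp [h1, h2, h3, hne, hP], hQ⟩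

/-- Now `A` must be long enough for every special block to receive a letter. -/
theorem length_special_insertPairs {seen A : List ℕ} {X : List Segment} {m : ℕ}
    (hX : ∀ l s r, Segment.triple l s r ∈ X → s.length = m) (hlen : numSpecial X ≤ A.length)
    {l s r : List ℕ} (h : Segment.triple l s r ∈ insertPairs seen A X) : s.length = m + 1 := by
  induction A, X using insertPairs_induction with
  | h0 A => simp at h
  | h1 X =>
    exfalso
    rw [insertPairs_nil] at h
    obtain ⟨X₁, X₂, rfl⟩ := List.append_of_mem h
    simp [numSpecial] at hlen
  | h2 A b X ih =>
    rw [insertPairs_plain, List.mem_cons] at h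
    refine ih (fun l s r h => hX l s r (by simp [h])) hlen (h.resolve_left (by simp))
  | h3 a A l' s' r' X ih =>
    rw [insertPairs_triple, List.mem_cons] at h
    rcases h with h | h
    · have := hX l' s' r' (by simp)
      split_ifs at h <;> simp only [Segment.triple.injEq] at h <;> rw [h.2.1] <;> simp [this]
    · exact ih (fun l s r h => hX l s r (by simp [h])) (by simpa [numSpecial] using hlen) h

/-! ### Substitution -/

theorem pair_left_injective (i : ℕ) : Function.Injective (Nat.pair i) := fun _ _ h =>
  (Nat.pair_eq_pair.1 h).2

/-- The copy of `X` that replaces the special block with number `i`. -/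
def copy (X : List Segment) (i : ℕ) : List Segment :=
  X.map (Segment.rename (Nat.pair (i + 1)))

theorem unpair_fst_of_mem_text_copy {X : List Segment} {i x : ℕ} (h : x ∈ text (copy X i)) :
    x.unpair.1 = i + 1 := by
  rw [copy, text_map_rename, List.mem_map] at h
  obtain ⟨y, -, rfl⟩ := h
  simp

theorem numSpecial_copy (X : List Segment) (i : ℕ) : numSpecial (copy X i) = numSpecial X :=
  numSpecial_map_rename _ _

theorem substitute_plain (X Y : List Segment) (i : ℕ) (seen b : List ℕ) :
    substitute X i seen (.plain b :: Y) = .plain b :: substitute X i (seen ++ b) Y := rfl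

theorem substitute_triple (X Y : List Segment) (i : ℕ) (seen l s r : List ℕ) :
    substitute X i seen (.triple l s r :: Y) =
      .plain l :: (insertPairs (seen ++ l) s (copy X i) ++
        .plain r :: substitute X (i + 1) (seen ++ l ++ s ++ r) Y) := rfl

theorem substitute_append (X Y₁ Y₂ : List Segment) (i : ℕ) (seen : List ℕ) :
    substitute X i seen (Y₁ ++ Y₂) = substitute X i seen Y₁ ++
      substitute X (i + numSpecial Y₁) (seen ++ text Y₁) Y₂ := by
  induction Y₁ generalizing i seen with
  | nil => simp [substitute, numSpecial]
  | cons S Y ih =>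
    cases S with
    | plain b => simp [substitute_plain, ih, numSpecial]
    | triple l s r =>
      have h : i + 1 + numSpecial Y = i + (numSpecial Y + 1) := by omega
      simp [substitute_triple, ih, numSpecial, h]

theorem numSpecial_substitute (X Y : List Segment) (i : ℕ) (seen : List ℕ) :
    numSpecial (substitute X i seen Y) = numSpecial Y * numSpecial X := by
  induction Y generalizing i seen with
  | nil => simp [substitute, numSpecial]
  | cons S Y ih =>
    cases S with
    | plain b => simpa [substitute_plain, numSpecial] using ih _ _
    | triple l s r =>
      simp only [substitute_triple, numSpecial, numSpecial_append, numSpecial_insertPairs,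
        numSpecial_copy, ih]
      ring

/-- Each special block of `Y` gives way to all blocks of a copy; the removed blocks are added on the
left to avoid subtraction. -/
theorem length_blocks_substitute (X Y : List Segment) (i : ℕ) (seen : List ℕ) :
    (blocks (substitute X i seen Y)).length + numSpecial Y =
      (blocks Y).length + numSpecial Y * (blocks X).length := by
  induction Y generalizing i seen with
  | nil => simp [substitute, numSpecial]
  | cons S Y ih =>
    cases S with
    | plain b =>
      have := ih i (seen ++ b)
      simp only [substitute_plain, numSpecial, blocks_plain, List.length_cons]
      omega
    | triple l s r =>
      have h1 := ih (i + 1) (seen ++ l ++ s ++ r)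
      have h2 : (blocks (copy X i)).length = (blocks X).length := by
        simp [copy, blocks_map_rename]
      simp only [substitute_triple, numSpecial, blocks_plain, blocks_append, blocks_triple,
        List.length_cons, List.length_append, length_blocks_insertPairs, h2, Nat.succ_mul]
      omega

/-- The conditions on `Y` under which the special blocks of `Y` can be replaced by copies of a
list with `n` special blocks. -/
structure Outer (n : ℕ) (Y : List Segment) : Prop where
  unpair_fst : ∀ y ∈ text Y, y.unpair.1 = 0
  distinct : DistinctInBlocks (blocks Y)
  length_special : ∀ l s r, Segment.triple l s r ∈ Y → s.length = n

theorem Outer.of_append {n : ℕ} {Y₁ Y₂ : List Segment} (h : Outer n (Y₁ ++ Y₂)) :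
    Outer n Y₁ ∧ Outer n Y₂ :=
  ⟨⟨fun y hy => h.1 y (by simp [hy]), fun b hb => h.2 b (by simp [hb]),
    fun l s r hs => h.3 l s r (by simp [hs])⟩,
   ⟨fun y hy => h.1 y (by simp [hy]), fun b hb => h.2 b (by simp [hb]),
    fun l s r hs => h.3 l s r (by simp [hs])⟩⟩

theorem Outer.tail {n : ℕ} {S : Segment} {Y : List Segment} (h : Outer n (S :: Y)) : Outer n Y :=
  (Outer.of_append (Y₁ := [S]) h).2

theorem Outer.triple {n : ℕ} {l s r : List ℕ} {Y : List Segment}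
    (h : Outer n (.triple l s r :: Y)) :
    (l.Nodup ∧ s.Nodup ∧ r.Nodup) ∧ s.length = n ∧
      (∀ y ∈ l, y.unpair.1 = 0) ∧ (∀ y ∈ s, y.unpair.1 = 0) ∧ ∀ y ∈ r, y.unpair.1 = 0 :=
  ⟨⟨h.2 _ (by simp), h.2 _ (by simp), h.2 _ (by simp)⟩, h.3 l s r (by simp),
    fun y hy => h.1 y (by simp [hy]), fun y hy => h.1 y (by simp [hy]),
    fun y hy => h.1 y (by simp [hy])⟩

theorem notMem_text_copy {X : List Segment} {i y : ℕ} (hy : y.unpair.1 = 0) :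
    y ∉ text (copy X i) := fun h => by
  rw [unpair_fst_of_mem_text_copy h] at hy; omega

theorem distinctInBlocks_substitute {X Y : List Segment} (hX : DistinctInBlocks (blocks X))
    (hY : Outer (numSpecial X) Y) (i : ℕ) (seen : List ℕ) :
    DistinctInBlocks (blocks (substitute X i seen Y)) := by
  induction Y generalizing i seen with
  | nil => simpa [substitute] using hY.distinct
  | cons S Y ih =>
    cases S with
    | plain b =>
      have h1 := ih hY.tail i (seen ++ b)
      have h2 : b.Nodup := hY.distinct b (by simp)
      simp only [DistinctInBlocks, substitute_plain, blocks_plain, List.forall_mem_cons]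
      exact ⟨h2, h1⟩
    | triple l s r =>
      have h1 := ih hY.tail (i + 1) (seen ++ l ++ s ++ r)
      obtain ⟨⟨hl, -, hr⟩, -, -, hs0, -⟩ := hY.triple
      have h2 : DistinctInBlocks (blocks (copy X i)) := by
        intro b hb
        rw [copy, blocks_map_rename, List.mem_map] at hb
        obtain ⟨c, hc, rfl⟩ := hb
        exact (hX c hc).map (pair_left_injective _)
      have h3 := distinctInBlocks_insertPairs (seen := seen ++ l) (A := s) h2
        fun a ha => notMem_text_copy (hs0 a ha)
      simp only [DistinctInBlocks, substitute_triple, blocks_plain, blocks_append,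
        List.forall_mem_cons, List.forall_mem_append]
      exact ⟨hl, h3, hr, h1⟩

theorem length_special_substitute {X Y : List Segment} {m : ℕ}
    (hX : ∀ l s r, Segment.triple l s r ∈ X → s.length = m) (hY : Outer (numSpecial X) Y)
    {i : ℕ} {seen l s r : List ℕ} (h : Segment.triple l s r ∈ substitute X i seen Y) :
    s.length = m + 1 := by
  induction Y generalizing i seen with
  | nil => simp [substitute] at h
  | cons S Y ih =>
    cases S with
    | plain b =>
      rw [substitute_plain, List.mem_cons] at h
      exact ih hY.tail (h.resolve_left (by simp))
    | triple l' s' r' =>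
      simp only [substitute_triple, List.mem_cons, List.mem_append, reduceCtorEq, false_or] at h
      rcases h with h | h
      · refine length_special_insertPairs (m := m) (fun l s r h => ?_) ?_ h
        · obtain ⟨S, hS, heq⟩ := List.mem_map.1 h
          cases S with
          | plain b => simp [Segment.rename] at heq
          | triple l' s' r' =>
            simp only [Segment.rename, Segment.triple.injEq] at heq
            rw [← heq.2.1, List.length_map]
            exact hX _ _ _ hS
        · rw [numSpecial_copy, hY.triple.2.1]
      · exact ih hY.tail h

/-- The effect of the substitution on the profile of an outer letter: a special occurrence becomes
two occurrences. The first argument tells whether the letter has been seen before. -/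
def expand : Bool → List Bool → List Bool
  | _, [] => []
  | _, false :: L => false :: expand true L
  | seen, true :: L => (if seen then [false, true] else [true, false]) ++ expand true L

theorem expand_replicate (n : ℕ) : expand true (List.replicate n false ++ [true]) =
    List.replicate n false ++ [false, true] := by
  induction n with
  | zero => rfl
  | succ n ih => simp [List.replicate_succ, expand, ih]

theorem profile_substitute_outer {X Y : List Segment} (hY : Outer (numSpecial X) Y) {y : ℕ}
    (hy : y.unpair.1 = 0) (i : ℕ) (seen : List ℕ) :
    profile y (substitute X i seen Y) = expand (decide (y ∈ seen)) (profile y Y) := by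
  induction Y generalizing i seen with
  | nil => simp [substitute, profile, expand]
  | cons S Y ih =>
    cases S with
    | plain b =>
      have hb : b.Nodup := hY.distinct b (by simp)
      have h1 := ih hY.tail i (seen ++ b)
      by_cases hyb : y ∈ b
      · simp [substitute_plain, profile, h1, hyb, expand, List.count_eq_one_of_mem hb hyb]
      · simp [substitute_plain, profile, h1, hyb, List.count_eq_zero_of_not_mem hyb]
    | triple l s r =>
      have h1 := ih hY.tail (i + 1) (seen ++ l ++ s ++ r)
      obtain ⟨⟨hl, hs, hr⟩, hlen, -⟩ := hY.triple
      have hc : y ∉ text (copy X i) := notMem_text_copy hy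
      have h2 : profile y (insertPairs (seen ++ l) s (copy X i)) =
          if y ∈ s then (if y ∈ seen ++ l then [false, true] else [true, false]) else [] := by
        split_ifs with h h'
        · rw [profile_insertPairs_of_mem h hs hc (by rw [numSpecial_copy, hlen]), if_pos h']
        · rw [profile_insertPairs_of_mem h hs hc (by rw [numSpecial_copy, hlen]), if_neg h']
        · rw [profile_insertPairs_of_notMem h, profile_eq_nil_iff.2 hc]
      have cl : l.count y = if y ∈ l then 1 else 0 := by
        split_ifs with h
        exacts [List.count_eq_one_of_mem hl h, List.count_eq_zero_of_not_mem h]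
      have cs : s.count y = if y ∈ s then 1 else 0 := by
        split_ifs with h
        exacts [List.count_eq_one_of_mem hs h, List.count_eq_zero_of_not_mem h]
      have cr : r.count y = if y ∈ r then 1 else 0 := by
        split_ifs with h
        exacts [List.count_eq_one_of_mem hr h, List.count_eq_zero_of_not_mem h]
      simp only [substitute_triple, profile, profile_append, h1, h2, cl, cs, cr]
      -- Blocks have distinct letters, so each of the three blocks contributes at most one
      -- occurrence, and the status of `y` changes from new to seen at its first one.
      by_cases u1 : y ∈ l <;> by_cases u2 : y ∈ s <;> by_cases u3 : y ∈ r <;>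
        simp [u1, u2, u3, expand]

theorem profile_substitute_inner {X Y : List Segment} (hY : Outer (numSpecial X) Y) (j x i : ℕ)
    (seen : List ℕ) :
    profile (Nat.pair (j + 1) x) (substitute X i seen Y) =
      if i ≤ j ∧ j < i + numSpecial Y then profile x X else [] := by
  induction Y generalizing i seen with
  | nil =>
    rw [if_neg (by simp only [numSpecial]; omega)]
    rfl
  | cons S Y ih =>
    have hx : ∀ b : List ℕ, (∀ y ∈ b, y.unpair.1 = 0) → Nat.pair (j + 1) x ∉ b := by
      intro b hb hm
      have := hb _ hm
      simp at this
    cases S with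
    | plain b =>
      have hb := hx b fun y hy => hY.unpair_fst y (by simp [hy])
      rw [show numSpecial (.plain b :: Y) = numSpecial Y from rfl]
      simp [substitute_plain, profile, ih hY.tail, List.count_eq_zero_of_not_mem hb]
    | triple l s r =>
      obtain ⟨-, -, hl, hs, hr⟩ := hY.triple
      have h1 : profile (Nat.pair (j + 1) x) (copy X i) = if i = j then profile x X else [] := by
        split_ifs with h
        · rw [h, copy, profile_map_rename (pair_left_injective _)]
        · rw [profile_eq_nil_iff]
          intro hm
          have := unpair_fst_of_mem_text_copy hm
          simp at this
          omega
      rw [show numSpecial (.triple l s r :: Y) = numSpecial Y + 1 from rfl]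
      simp only [substitute_triple, profile, profile_append, ih hY.tail,
        List.count_eq_zero_of_not_mem (hx l hl), List.count_eq_zero_of_not_mem (hx r hr),
        profile_insertPairs_of_notMem (hx s hs), h1, List.replicate_zero,
        List.nil_append]
      rcases lt_trichotomy i j with h | h | h
      · rw [if_neg h.ne, List.nil_append]
        exact if_congr (by omega) rfl rfl
      · rw [if_pos h, if_neg (by omega), if_pos (by omega), List.append_nil]
      · rw [if_neg (by omega), if_neg (by omega), if_neg (by omega), List.append_nil]

/-- Restricted to outer letters, the new word is that of `Y` with the special occurrences doubled.
-/
theorem collapses_substitute {X Y : List Segment} (hY : Outer (numSpecial X) Y) (i : ℕ)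
    (seen : List ℕ) :
    Collapses ((text (substitute X i seen Y)).filter fun y => y.unpair.1 = 0) (text Y) := by
  induction Y generalizing i seen with
  | nil => exact Collapses.refl _
  | cons S Y ih =>
    have hx : ∀ b : List ℕ, (∀ y ∈ b, y.unpair.1 = 0) →
        b.filter (fun y => decide (y.unpair.1 = 0)) = b := fun b hb =>
      List.filter_eq_self.2 fun y hy => by simpa using hb y hy
    cases S with
    | plain b =>
      rw [substitute_plain, text_plain, text_plain, List.filter_append,
        hx b fun y hy => hY.unpair_fst y (by simp [hy])]
      exact (Collapses.refl _).append (ih hY.tail _ _)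
    | triple l s r =>
      obtain ⟨-, hlen, hl, hs, hr⟩ := hY.triple
      rw [substitute_triple, text_plain, text_append, text_plain, text_triple, List.filter_append,
        List.filter_append, List.filter_append, hx l hl, hx r hr,
        filter_text_insertPairs_of_true (fun a ha => by simpa using hs a ha)
          (fun x hx => by simp [unpair_fst_of_mem_text_copy hx])
          (by rw [numSpecial_copy, hlen])]
      exact (Collapses.refl _).append ((collapses_flatMap_pair s).append
        ((Collapses.refl _).append (ih hY.tail _ _)))

theorem mem_text_of_mem_text_substitute {X Y : List Segment} (hY : Outer (numSpecial X) Y) {y : ℕ}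
    (hy : y.unpair.1 = 0) {i : ℕ} {seen : List ℕ} (h : y ∈ text (substitute X i seen Y)) :
    y ∈ text Y := by
  by_contra hn
  rw [← profile_eq_nil_iff] at hn
  have h1 := profile_substitute_outer hY hy i seen
  rw [hn, expand, profile_eq_nil_iff] at h1
  exact h1 h

theorem unpair_fst_of_mem_text_substitute {X Y : List Segment} (hY : Outer (numSpecial X) Y)
    {i j x : ℕ} (hx : x.unpair.1 = j + 1) {seen : List ℕ} (h : x ∈ text (substitute X i seen Y)) :
    i ≤ j ∧ j < i + numSpecial Y := by
  by_contra hn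
  have h1 := profile_substitute_inner hY j x.unpair.2 i seen
  rw [if_neg hn, ← hx, Nat.pair_unpair, profile_eq_nil_iff] at h1
  exact h1 h

theorem exists_eq_append_triple {Y : List Segment} {j : ℕ} (hj : j < numSpecial Y) :
    ∃ Y₁ l s r Y₂, Y = Y₁ ++ .triple l s r :: Y₂ ∧ numSpecial Y₁ = j := by
  induction Y generalizing j with
  | nil => simp [numSpecial] at hj
  | cons S Y ih =>
    cases S with
    | plain b =>
      obtain ⟨Y₁, l, s, r, Y₂, rfl, h⟩ := ih (j := j) (by simpa [numSpecial] using hj)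
      exact ⟨.plain b :: Y₁, l, s, r, Y₂, rfl, by simpa [numSpecial] using h⟩
    | triple l s r =>
      cases j with
      | zero => exact ⟨[], l, s, r, Y, rfl, rfl⟩
      | succ j =>
        obtain ⟨Y₁, l', s', r', Y₂, rfl, h⟩ := ih (j := j) (by simpa [numSpecial] using hj)
        exact ⟨.triple l s r :: Y₁, l', s', r', Y₂, rfl, by simpa [numSpecial] using h⟩

/-- A special occurrence is the first or the last one, so a letter of a special block is absent from
one of the two sides. -/
theorem nil_of_append_true_append {n : ℕ} {P Q : List Bool}
    (h : P ++ true :: Q = true :: (List.replicate n false ++ [true])) : P = [] ∨ Q = [] := by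
  rcases P with _ | ⟨p, P⟩
  · exact Or.inl rfl
  right
  rcases List.eq_nil_or_concat Q with rfl | ⟨Q, q, rfl⟩
  · rfl
  rw [List.cons_append, List.cons.injEq] at h
  have h2 : (P ++ true :: Q) ++ [q] = List.replicate n false ++ [true] := by
    rw [← h.2]; simp
  have h3 := (List.append_inj' h2 rfl).1
  have : true ∈ List.replicate n false := by rw [← h3]; simp
  simp at this

/-- The part of the text that replaces a special block, and the parts before and after it. -/
theorem exists_text_substitute_eq {d : ℕ} {X Y : List Segment} (hY : Outer (numSpecial X) Y)
    (hYp : ∀ a, profile a Y = [] ∨ profile a Y = true :: (List.replicate d false ++ [true])) {j : ℕ}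
    (hj : j < numSpecial Y) :
    ∃ U V seen s, text (substitute X 0 [] Y) = U ++ (text (insertPairs seen s (copy X j)) ++ V) ∧
      s.Nodup ∧ s.length = numSpecial X ∧ (∀ a ∈ s, a.unpair.1 = 0) ∧
      (∀ x ∈ U, x.unpair.1 ≠ j + 1) ∧ (∀ x ∈ V, x.unpair.1 ≠ j + 1) ∧
      ∀ a ∈ s, a ∉ U ∨ a ∉ V := by
  obtain ⟨Y₁, l, s, r, Y₂, rfl, hj'⟩ := exists_eq_append_triple hj
  obtain ⟨o1, o2⟩ := hY.of_append
  obtain ⟨⟨-, hs, -⟩, hlen, hl0, hs0, hr0⟩ := o2.triple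
  refine ⟨text (substitute X 0 [] Y₁) ++ l,
    r ++ text (substitute X (j + 1) (text Y₁ ++ l ++ s ++ r) Y₂), text Y₁ ++ l, s, ?_, hs, hlen,
    hs0, ?_, ?_, ?_⟩
  · subst j
    simp [substitute_append, substitute_triple]
  · intro x hx hxj
    rcases List.mem_append.1 hx with hx | hx
    · have := unpair_fst_of_mem_text_substitute o1 hxj hx
      omega
    · rw [hl0 x hx] at hxj; omega
  · intro x hx hxj
    rcases List.mem_append.1 hx with hx | hx
    · rw [hr0 x hx] at hxj; omega
    · have := unpair_fst_of_mem_text_substitute o2.tail hxj hx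
      omega
  · intro a ha
    have hcount : s.count a = 1 := List.count_eq_one_of_mem hs ha
    have hprof : profile a (Y₁ ++ .triple l s r :: Y₂) =
        (profile a Y₁ ++ List.replicate (l.count a) false) ++
          true :: (List.replicate (r.count a) false ++ profile a Y₂) := by
      simp [profile_append, profile, hcount]
    have hgood : (profile a Y₁ ++ List.replicate (l.count a) false) = [] ∨
        (List.replicate (r.count a) false ++ profile a Y₂) = [] := by
      have := hYp a
      rw [hprof] at this
      exact nil_of_append_true_append (this.resolve_left (by simp))
    refine hgood.imp (fun h hm => ?_) (fun h hm => ?_)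
    · rw [List.append_eq_nil_iff, profile_eq_nil_iff, List.replicate_eq_nil_iff,
        List.count_eq_zero] at h
      exact (List.mem_append.1 hm).elim
        (fun h' => h.1 (mem_text_of_mem_text_substitute o1 (hs0 a ha) h')) h.2
    · rw [List.append_eq_nil_iff, profile_eq_nil_iff, List.replicate_eq_nil_iff,
        List.count_eq_zero] at h
      exact (List.mem_append.1 hm).elim h.1
        (fun h' => h.2 (mem_text_of_mem_text_substitute o2.tail (hs0 a ha) h'))

theorem lt_numSpecial_of_mem {X Y : List Segment} (hY : Outer (numSpecial X) Y) {j x : ℕ}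
    (hx : x.unpair.1 = j + 1) (h : x ∈ text (substitute X 0 [] Y)) : j < numSpecial Y := by
  have := unpair_fst_of_mem_text_substitute hY hx h
  omega

/-- A letter of a copy and a letter that does not belong to this copy appear in at most four
runs. -/
theorem exists_runs_substitute {d : ℕ} {X Y : List Segment} (hY : Outer (numSpecial X) Y)
    (hYp : ∀ a, profile a Y = [] ∨ profile a Y = true :: (List.replicate d false ++ [true]))
    {a b j : ℕ} (hb : b.unpair.1 = j + 1) (ha : a.unpair.1 ≠ j + 1)
    (hmem : b ∈ text (substitute X 0 [] Y)) :
    ∃ L : List (List ℕ), text (substitute X 0 [] Y) = L.flatten ∧ (∀ u ∈ L, a ∉ u ∨ b ∉ u) ∧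
      L.length ≤ 4 := by
  obtain ⟨U, V, seen, s, heq, hs, hlen, hs0, hU, hV, hUV⟩ :=
    exists_text_substitute_eq hY hYp (lt_numSpecial_of_mem hY hb hmem)
  have hbU : b ∉ U := fun h => hU b h hb
  have hbV : b ∉ V := fun h => hV b h hb
  by_cases has : a ∈ s
  · have hac : a ∉ text (copy X j) := notMem_text_copy (hs0 a has)
    obtain ⟨P, Q, hPQ, hP, hQ⟩ := exists_text_insertPairs_eq (seen := seen) has hs hac
      (by rw [numSpecial_copy, hlen])
    have hba : b ≠ a := fun h => ha (h ▸ hb)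
    -- The letter `b` lives only in `P` and `Q`, and `a` only in the pair and on one side of the
    -- copy. The side without `a` merges with the adjacent part of the copy, leaving four runs.
    rcases hUV a has with h | h
    · refine ⟨[U ++ P, [a, a], Q, V], by simp [heq, hPQ], ?_, by simp⟩
      simp [h, hP, hQ, hbV, hba]
    · refine ⟨[U, P, [a, a], Q ++ V], by simp [heq, hPQ], ?_, by simp⟩
      simp [h, hP, hQ, hbU, hba]
  · have haZ : a ∉ text (insertPairs seen s (copy X j)) := fun h =>
      (mem_text_insertPairs h).elim has fun h' => ha (unpair_fst_of_mem_text_copy h')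
    refine ⟨[U, text (insertPairs seen s (copy X j)), V], by simp [heq], ?_, by simp⟩
    simp [hbU, hbV, haZ]

/-- Two outer letters alternate as in `Y`, two letters of one copy as in `X`. In the remaining cases
at least one letter belongs to a copy that does not contain the other as an own letter, and the four
runs apply. -/
theorem avoidsAlternation_substitute {d : ℕ} {X Y : List Segment} (hY : Outer (numSpecial X) Y)
    (hYp : ∀ a, profile a Y = [] ∨ profile a Y = true :: (List.replicate d false ++ [true]))
    (hX : AvoidsAlternation 5 (text X)) (hYa : AvoidsAlternation 5 (text Y)) :
    AvoidsAlternation 5 (text (substitute X 0 [] Y)) := by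
  intro a b hab h
  obtain ⟨hma, hmb⟩ := mem_of_alternation_sublist h
  by_cases hk : a.unpair.1 = b.unpair.1
  · have hfilter : List.Sublist (alternation a b 5)
        ((text (substitute X 0 [] Y)).filter fun y => y.unpair.1 = a.unpair.1) := by
      have := h.filter fun y => decide (y.unpair.1 = a.unpair.1)
      rwa [List.filter_eq_self.2 (by simp [alternation, hk])] at this
    rcases Nat.eq_zero_or_eq_succ_pred a.unpair.1 with h0 | hj
    · rw [h0] at hfilter
      exact hYa a b hab (collapses_substitute hY 0 [] _ (isChain_alternation hab) hfilter)
    · generalize a.unpair.1.pred = j at hj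
      obtain ⟨U, V, seen, s, heq, -, -, hs0, hU, hV, -⟩ :=
        exists_text_substitute_eq hY hYp (lt_numSpecial_of_mem hY hj hma)
      rw [heq, hj, Nat.succ_eq_add_one, List.filter_append, List.filter_append,
        filter_text_insertPairs_of_false (fun a ha => by simp [hs0 a ha]),
        List.filter_eq_nil_iff (l := U) |>.2 (fun x hx => by simpa using hU x hx),
        List.filter_eq_nil_iff (l := V) |>.2 (fun x hx => by simpa using hV x hx), List.nil_append,
        List.append_nil] at hfilter
      have hXj : AvoidsAlternation 5 (text (copy X j)) := by
        rw [copy, text_map_rename]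
        exact hX.map (pair_left_injective _)
      exact hXj a b hab (hfilter.trans List.filter_sublist)
  · rcases Nat.eq_zero_or_eq_succ_pred b.unpair.1 with h0 | hj
    · have hj : a.unpair.1 = a.unpair.1.pred + 1 :=
        (Nat.eq_zero_or_eq_succ_pred a.unpair.1).resolve_left fun h => hk (h.trans h0.symm)
      obtain ⟨L, hL, hruns, hlen⟩ := exists_runs_substitute hY hYp hj
        (fun h => hk (hj.trans h.symm)) hma
      exact not_alternation_sublist hL (fun u hu => (hruns u hu).symm) hlen h
    · obtain ⟨L, hL, hruns, hlen⟩ := exists_runs_substitute hY hYp hj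
        (fun h => hk (h.trans hj.symm)) hmb
      exact not_alternation_sublist hL hruns hlen h

/-- The inductive step for the sequences `G_d(m)`. -/
theorem Good.substitute {d m : ℕ} {X Y : List Segment} (hX : Good (d + 1) m X)
    (hY : Good d (numSpecial X) Y) :
    Good (d + 1) (m + 1)
      (BlockSeq.substitute X 0 [] (Y.map (Segment.rename (Nat.pair 0)))) := by
  have hY' := hY.rename (pair_left_injective 0)
  have hO : Outer (numSpecial X) (Y.map (Segment.rename (Nat.pair 0))) := by
    refine ⟨fun y hy => ?_, hY'.distinct, hY'.length_special⟩
    rw [text_map_rename, List.mem_map] at hy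
    obtain ⟨x, -, rfl⟩ := hy
    simp
  refine ⟨distinctInBlocks_substitute hX.distinct hO 0 [], fun a => ?_,
    avoidsAlternation_substitute hO hY'.profile hX.avoids hY'.avoids,
    fun l s r h => length_special_substitute hX.length_special hO h⟩
  rcases Nat.eq_zero_or_eq_succ_pred a.unpair.1 with h0 | hj
  · rw [profile_substitute_outer hO h0]
    rcases hY'.profile a with h | h
    · left; rw [h]; rfl
    · right
      rw [h]
      -- The doubled last occurrence supplies one new regular occurrence; the doubled first one
      -- supplies the other.
      have h1 : List.replicate (2 * d) false ++ [false, true] =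
          List.replicate (2 * d + 1) false ++ [true] := by
        rw [List.replicate_add]; simp
      simp only [List.not_mem_nil, decide_false, expand, Bool.false_eq_true, if_false,
        expand_replicate, h1]
      rw [show 2 * (d + 1) = (2 * d + 1) + 1 by ring, List.replicate_succ (n := 2 * d + 1)]
      simp
  · have := profile_substitute_inner hO a.unpair.1.pred a.unpair.2 0 []
    rw [← Nat.succ_eq_add_one, ← hj, Nat.pair_unpair] at this
    rw [this]
    split_ifs
    · exact hX.profile _
    · exact Or.inl rfl

/-! ### The sequences `G_1(m)` -/

/-- The letters with last appearance in fan `i`, in reverse order of their first fans. -/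
def lastLetters (i : ℕ) : List ℕ := ((List.range i).map fun j => Nat.pair j i).reverse

/-- The letters with first appearance in fan `i`, in order of their last fans. -/
def firstLetters (m i : ℕ) : List ℕ := (List.range' (i + 1) (m - i)).map fun j => Nat.pair i j

theorem fan_eq (m i : ℕ) : fan m i = .triple (lastLetters i)
    ((lastLetters i).reverse ++ firstLetters m i) (firstLetters m i).reverse := rfl

theorem mem_lastLetters {t x : ℕ} : x ∈ lastLetters t ↔ x.unpair.1 < t ∧ x.unpair.2 = t := by
  simp only [lastLetters, List.mem_reverse, List.mem_map, List.mem_range]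
  constructor
  · rintro ⟨j, hj, rfl⟩
    simpa using hj
  · rintro ⟨h, rfl⟩
    exact ⟨_, h, Nat.pair_unpair x⟩

theorem mem_firstLetters {m t x : ℕ} :
    x ∈ firstLetters m t ↔ x.unpair.1 = t ∧ t < x.unpair.2 ∧ x.unpair.2 ≤ m := by
  simp only [firstLetters, List.mem_map, List.mem_range'_1]
  constructor
  · rintro ⟨j, hj, rfl⟩
    simp only [Nat.unpair_pair, true_and]
    omega
  · rintro ⟨rfl, h⟩
    exact ⟨x.unpair.2, by omega, Nat.pair_unpair x⟩

theorem nodup_lastLetters (i : ℕ) : (lastLetters i).Nodup :=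
  List.nodup_reverse.2 (List.nodup_range.map fun _ _ h => (Nat.pair_eq_pair.1 h).1)

theorem nodup_firstLetters (m i : ℕ) : (firstLetters m i).Nodup :=
  List.Nodup.map (pair_left_injective i) List.nodup_range'

theorem distinctInBlocks_fans (m : ℕ) : DistinctInBlocks (blocks (fans m)) := by
  intro b hb
  simp only [blocks, fans, List.mem_flatMap, List.mem_map] at hb
  obtain ⟨S, ⟨i, -, rfl⟩, hb⟩ := hb
  simp only [fan_eq, Segment.blocks, List.mem_cons, List.not_mem_nil, or_false] at hb
  rcases hb with rfl | rfl | rfl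
  · exact nodup_lastLetters i
  · refine List.Nodup.append (List.nodup_reverse.2 (nodup_lastLetters i))
      (nodup_firstLetters m i) fun x hx hx' => ?_
    rw [List.mem_reverse, mem_lastLetters] at hx
    rw [mem_firstLetters] at hx'
    omega
  · exact List.nodup_reverse.2 (nodup_firstLetters m i)

theorem length_special_fans {m : ℕ} {l s r : List ℕ} (h : Segment.triple l s r ∈ fans m) :
    s.length = m := by
  simp only [fans, List.mem_map, List.mem_range] at h
  obtain ⟨i, hi, heq⟩ := h
  rw [fan_eq, Segment.triple.injEq] at heq
  rw [← heq.2.1]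
  simp [lastLetters, firstLetters]
  omega

/-- The palindrome with number `t`: the letters with last appearance in fan `t / 2` if `t` is even,
those with first appearance in this fan if `t` is odd. -/
def palindrome (m t : ℕ) : List ℕ :=
  let p := if t % 2 = 0 then lastLetters (t / 2) else firstLetters m (t / 2)
  p ++ p.reverse

theorem palindrome_even (m t : ℕ) :
    palindrome m (2 * t) = lastLetters t ++ (lastLetters t).reverse := by
  simp [palindrome]

theorem palindrome_odd (m t : ℕ) :
    palindrome m (2 * t + 1) = firstLetters m t ++ (firstLetters m t).reverse := by
  have h : (2 * t + 1) / 2 = t := by omega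
  simp [palindrome, h, Nat.add_mod]

/-- The concatenation of the palindromes with the numbers `x, ..., y - 1`. -/
def palindromes (m x y : ℕ) : List ℕ := (List.range' x (y - x)).flatMap (palindrome m)

theorem palindromes_append (m : ℕ) {x y z : ℕ} (hxy : x ≤ y) (hyz : y ≤ z) :
    palindromes m x z = palindromes m x y ++ palindromes m y z := by
  have h : List.range' x (z - x) = List.range' x (y - x) ++ List.range' y (z - y) := by
    have h1 : z - x = (y - x) + (z - y) := by omega
    rw [h1, ← List.range'_append_1]
    congr 2
    omega
  rw [palindromes, h, List.flatMap_append]; rfl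

theorem palindromes_succ (m x : ℕ) : palindromes m x (x + 1) = palindrome m x := by
  simp [palindromes]

/-- The letter of the fans `j < i` lies only in the palindromes `2 * j + 1` and `2 * i`; its
position is thus controlled by comparing these numbers with `x` and `y`. -/
theorem mem_palindromes {m x y a : ℕ} (hy : y ≤ 2 * (m + 1)) (h : a ∈ palindromes m x y) :
    a.unpair.1 < a.unpair.2 ∧ a.unpair.2 ≤ m ∧
      ((x ≤ 2 * a.unpair.1 + 1 ∧ 2 * a.unpair.1 + 1 < y) ∨
        (x ≤ 2 * a.unpair.2 ∧ 2 * a.unpair.2 < y)) := by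
  simp only [palindromes, List.mem_flatMap, List.mem_range'_1] at h
  obtain ⟨t, ht, ha⟩ := h
  obtain ⟨u, rfl | rfl⟩ := Nat.even_or_odd' t
  · rw [palindrome_even, List.mem_append, List.mem_reverse, or_self, mem_lastLetters] at ha
    omega
  · rw [palindrome_odd, List.mem_append, List.mem_reverse, or_self, mem_firstLetters] at ha
    omega

theorem text_map_fan (m n : ℕ) : text ((List.range n).map (fan m)) = palindromes m 0 (2 * n) := by
  induction n with
  | zero => simp [palindromes]
  | succ n ih =>
    rw [palindromes_append m (Nat.zero_le (2 * n)) (by omega),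
      palindromes_append m (x := 2 * n) (y := 2 * n + 1) (by omega) (by omega),
      show 2 * (n + 1) = 2 * n + 1 + 1 by ring, palindromes_succ, palindromes_succ, palindrome_even,
      palindrome_odd, ← ih, List.range_succ, List.map_append, text_append]
    simp [fan_eq]

theorem mem_text_fans {m a : ℕ} (h : a ∈ text (fans m)) :
    a.unpair.1 < a.unpair.2 ∧ a.unpair.2 ≤ m := by
  rw [fans, text_map_fan] at h
  have := mem_palindromes le_rfl h
  exact ⟨this.1, this.2.1⟩

theorem profile_map_fan {m a : ℕ} (ha : a.unpair.1 < a.unpair.2) (ham : a.unpair.2 ≤ m) (n : ℕ) :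
    profile a ((List.range n).map (fan m)) = (if a.unpair.1 < n then [true, false] else []) ++
      if a.unpair.2 < n then [false, true] else [] := by
  induction n with
  | zero => simp [profile]
  | succ n ih =>
    have c1 : (lastLetters n).count a = if a.unpair.2 = n then 1 else 0 := by
      split_ifs with h
      · exact List.count_eq_one_of_mem (nodup_lastLetters n) (mem_lastLetters.2 (by omega))
      · exact List.count_eq_zero_of_not_mem fun h' => h (mem_lastLetters.1 h').2
    have c2 : (firstLetters m n).count a = if a.unpair.1 = n then 1 else 0 := by
      split_ifs with h
      · exact List.count_eq_one_of_mem (nodup_firstLetters m n) (mem_firstLetters.2 (by omega))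
      · exact List.count_eq_zero_of_not_mem fun h' => h (mem_firstLetters.1 h').1
    rw [List.range_succ, List.map_append, profile_append, ih]
    simp only [List.map_cons, List.map_nil, fan_eq, profile, List.count_append,
      List.count_reverse, c1, c2, List.append_nil]
    generalize a.unpair.1 = j at *
    generalize a.unpair.2 = i at *
    have key : ∀ k : ℕ, k < n ∧ k ≠ n ∧ k < n + 1 ∨ k = n ∧ ¬ k < n ∧ k < n + 1 ∨
        ¬ k < n ∧ k ≠ n ∧ ¬ k < n + 1 := by omega
    rcases key j with ⟨h1, h2, h3⟩ | ⟨h1, h2, h3⟩ | ⟨h1, h2, h3⟩ <;>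
      rcases key i with ⟨k1, k2, k3⟩ | ⟨k1, k2, k3⟩ | ⟨k1, k2, k3⟩ <;>
      first
        | (exfalso; omega)
        | simp [h1, h2, h3, k1, k2, k3]

theorem firstLetters_split {m t i : ℕ} (h1 : t < i) (h2 : i ≤ m) :
    ∃ q₁ q₂, firstLetters m t = q₁ ++ Nat.pair t i :: q₂ ∧ (∀ x ∈ q₁, x.unpair.2 < i) ∧
      ∀ x ∈ q₂, i < x.unpair.2 := by
  refine ⟨(List.range' (t + 1) (i - (t + 1))).map (Nat.pair t),
    (List.range' (i + 1) (m - i)).map (Nat.pair t), ?_, ?_, ?_⟩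
  · have h : m - t = (i - (t + 1)) + ((m - i) + 1) := by omega
    rw [firstLetters, h, ← List.range'_append_1, List.range'_succ, List.map_append, List.map_cons,
      show t + 1 + (i - (t + 1)) = i by omega]
  · simp only [List.mem_map, List.mem_range'_1]
    rintro x ⟨k, hk, rfl⟩
    simp only [Nat.unpair_pair]; omega
  · simp only [List.mem_map, List.mem_range'_1]
    rintro x ⟨k, hk, rfl⟩
    simp only [Nat.unpair_pair]; omega

theorem lastLetters_split {t j : ℕ} (h : j < t) :
    ∃ p₁ p₂, lastLetters t = p₁ ++ Nat.pair j t :: p₂ ∧ (∀ x ∈ p₁, j < x.unpair.1) ∧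
      ∀ x ∈ p₂, x.unpair.1 < j := by
  refine ⟨((List.range' (j + 1) (t - (j + 1))).map fun k => Nat.pair k t).reverse,
    ((List.range j).map fun k => Nat.pair k t).reverse, ?_, ?_, ?_⟩
  · have h1 : List.range t = List.range j ++ j :: List.range' (j + 1) (t - (j + 1)) := by
      have h2 : t = j + ((t - (j + 1)) + 1) := by omega
      conv_lhs => rw [h2, List.range_eq_range', ← List.range'_append_1, List.range'_succ, zero_add]
      rw [List.range_eq_range']
    rw [lastLetters, h1]
    simp
  · simp only [List.mem_reverse, List.mem_map, List.mem_range'_1]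
    rintro x ⟨k, hk, rfl⟩
    simp only [Nat.unpair_pair]; omega
  · simp only [List.mem_reverse, List.mem_map, List.mem_range]
    rintro x ⟨k, hk, rfl⟩
    simpa using hk

/-- Letters without a common palindrome give the patterns `aabb`, `abab` or `abba` of runs. A common
palindrome would add too many runs if the orders inside the palindromes were not chosen suitably. -/
theorem exists_runs_fans {m a b : ℕ} (ha : a.unpair.1 < a.unpair.2)
    (ham : a.unpair.2 ≤ m) (hb : b.unpair.1 < b.unpair.2) (hbm : b.unpair.2 ≤ m)
    (hlt : a.unpair.1 < b.unpair.1 ∨ a.unpair.1 = b.unpair.1 ∧ a.unpair.2 < b.unpair.2) :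
    ∃ L : List (List ℕ), text (fans m) = L.flatten ∧ (∀ u ∈ L, a ∉ u ∨ b ∉ u) ∧
      L.length ≤ 4 := by
  have hmem : ∀ {c x y}, y ≤ 2 * (m + 1) →
      ¬ (x ≤ 2 * c.unpair.1 + 1 ∧ 2 * c.unpair.1 + 1 < y) →
      ¬ (x ≤ 2 * c.unpair.2 ∧ 2 * c.unpair.2 < y) → c ∉ palindromes m x y := by
    intro c x y hy h1 h2 hc
    have := (mem_palindromes hy hc).2.2
    tauto
  have htext : ∀ {x y z}, x ≤ y → y ≤ z → z ≤ 2 * (m + 1) →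
      text (fans m) = [palindromes m 0 x, palindromes m x y, palindromes m y z,
        palindromes m z (2 * (m + 1))].flatten := by
    intro x y z hxy hyz hz
    rw [fans, text_map_fan, palindromes_append m (Nat.zero_le x) (by omega),
      palindromes_append m hxy (by omega), palindromes_append m hyz hz]
    simp
  rcases hlt with hlt | ⟨heq, hlt⟩
  · rcases lt_trichotomy a.unpair.2 b.unpair.2 with h | h | h
    · by_cases h' : a.unpair.2 ≤ b.unpair.1
      · refine ⟨_, htext (x := 2 * a.unpair.2) (y := 2 * b.unpair.1 + 1) (z := 2 * b.unpair.2)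
          (by omega) (by omega) (by omega), ?_, by simp⟩
        simp only [List.forall_mem_cons, List.not_mem_nil, false_imp_iff, implies_true, and_true]
        exact ⟨Or.inr (hmem (by omega) (by omega) (by omega)),
          Or.inr (hmem (by omega) (by omega) (by omega)),
          Or.inl (hmem (by omega) (by omega) (by omega)),
          Or.inl (hmem (by omega) (by omega) (by omega))⟩
      · refine ⟨_, htext (x := 2 * b.unpair.1 + 1) (y := 2 * a.unpair.2) (z := 2 * b.unpair.2)
          (by omega) (by omega) (by omega), ?_, by simp⟩
        simp only [List.forall_mem_cons, List.not_mem_nil, false_imp_iff, implies_true, and_true]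
        exact ⟨Or.inr (hmem (by omega) (by omega) (by omega)),
          Or.inl (hmem (by omega) (by omega) (by omega)),
          Or.inr (hmem (by omega) (by omega) (by omega)),
          Or.inl (hmem (by omega) (by omega) (by omega))⟩
    -- Common last fan: the reverse order of the first fans puts `b` outside, so the palindrome
    -- reads `baab`. After the earlier `a` and `b`, the runs are `a`, `b`, `a`, `b`.
    · obtain ⟨p₁, p₂, hp, hp₁, hp₂⟩ := lastLetters_split ha
      rw [Nat.pair_unpair] at hp
      refine ⟨[palindromes m 0 (2 * b.unpair.1 + 1),
        palindromes m (2 * b.unpair.1 + 1) (2 * a.unpair.2) ++ p₁, a :: p₂ ++ (a :: p₂).reverse,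
        p₁.reverse ++ palindromes m (2 * a.unpair.2 + 1) (2 * (m + 1))], ?_, ?_, by simp⟩
      · rw [fans, text_map_fan, palindromes_append m (Nat.zero_le (2 * b.unpair.1 + 1)) (by omega),
          palindromes_append m (x := 2 * b.unpair.1 + 1) (y := 2 * a.unpair.2) (by omega) (by omega),
          palindromes_append m (x := 2 * a.unpair.2) (y := 2 * a.unpair.2 + 1) (by omega) (by omega),
          palindromes_succ, palindrome_even, hp]
        simp
      · have u1 : a ∉ p₁ := fun h => lt_irrefl _ (hp₁ a h)
        have u2 : b ∉ p₂ := fun h => (hp₂ b h).not_gt hlt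
        have u3 : b ≠ a := fun h => hlt.ne (by rw [h])
        simp only [List.forall_mem_cons, List.not_mem_nil, false_imp_iff, implies_true, and_true]
        simp only [List.mem_append, List.mem_reverse, List.mem_cons, or_self, not_or]
        exact ⟨Or.inr (hmem (by omega) (by omega) (by omega)),
          Or.inl ⟨hmem (by omega) (by omega) (by omega), u1⟩, Or.inr ⟨u3, u2⟩,
          Or.inl ⟨u1, hmem (by omega) (by omega) (by omega)⟩⟩
    · refine ⟨_, htext (x := 2 * b.unpair.1 + 1) (y := 2 * b.unpair.2 + 1) (z := 2 * a.unpair.2)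
        (by omega) (by omega) (by omega), ?_, by simp⟩
      simp only [List.forall_mem_cons, List.not_mem_nil, false_imp_iff, implies_true, and_true]
      exact ⟨Or.inr (hmem (by omega) (by omega) (by omega)),
        Or.inl (hmem (by omega) (by omega) (by omega)),
        Or.inl (hmem (by omega) (by omega) (by omega)),
        Or.inr (hmem (by omega) (by omega) (by omega))⟩
  -- Common first fan: the order of the last fans puts `a` outside, so the palindrome reads `abba`.
  -- Its final `a` joins the next run of `a`, and `b` comes last.
  · obtain ⟨q₁, q₂, hq, hq₁, hq₂⟩ := firstLetters_split hb hbm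
    rw [Nat.pair_unpair] at hq
    refine ⟨[palindromes m 0 (2 * b.unpair.1 + 1) ++ q₁, b :: q₂ ++ (b :: q₂).reverse,
      q₁.reverse ++ palindromes m (2 * b.unpair.1 + 2) (2 * b.unpair.2),
      palindromes m (2 * b.unpair.2) (2 * (m + 1))], ?_, ?_, by simp⟩
    · rw [fans, text_map_fan, palindromes_append m (Nat.zero_le (2 * b.unpair.1 + 1)) (by omega),
        palindromes_append m (x := 2 * b.unpair.1 + 1) (y := 2 * b.unpair.1 + 2) (by omega)
          (by omega),
        palindromes_append m (x := 2 * b.unpair.1 + 2) (y := 2 * b.unpair.2) (by omega) (by omega),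
        palindromes_succ, palindrome_odd, hq]
      simp
    · have u1 : b ∉ q₁ := fun h => lt_irrefl _ (hq₁ b h)
      have u2 : a ∉ q₂ := fun h => (hq₂ a h).not_gt hlt
      have u3 : a ≠ b := fun h => hlt.ne (by rw [h])
      simp only [List.forall_mem_cons, List.not_mem_nil, false_imp_iff, implies_true, and_true]
      simp only [List.mem_append, List.mem_reverse, List.mem_cons, or_self, not_or]
      exact ⟨Or.inr ⟨hmem (by omega) (by omega) (by omega), u1⟩, Or.inl ⟨u3, u2⟩,
        Or.inr ⟨u1, hmem (by omega) (by omega) (by omega)⟩,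
        Or.inl (hmem (by omega) (by omega) (by omega))⟩

theorem avoidsAlternation_fans (m : ℕ) : AvoidsAlternation 5 (text (fans m)) := by
  intro a b hab h
  obtain ⟨hma, hmb⟩ := mem_of_alternation_sublist h
  obtain ⟨ha, ham⟩ := mem_text_fans hma
  obtain ⟨hb, hbm⟩ := mem_text_fans hmb
  have hne : a.unpair.1 ≠ b.unpair.1 ∨ a.unpair.2 ≠ b.unpair.2 := by
    by_contra! hcon
    exact hab (by rw [← Nat.pair_unpair a, ← Nat.pair_unpair b, hcon.1, hcon.2])
  by_cases hlt : a.unpair.1 < b.unpair.1 ∨ a.unpair.1 = b.unpair.1 ∧ a.unpair.2 < b.unpair.2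
  · obtain ⟨L, hL, hruns, hlen⟩ := exists_runs_fans ha ham hb hbm hlt
    exact not_alternation_sublist hL hruns hlen h
  · obtain ⟨L, hL, hruns, hlen⟩ := exists_runs_fans hb hbm ha ham (by omega)
    exact not_alternation_sublist hL (fun u hu => (hruns u hu).symm) hlen h

theorem good_fans (m : ℕ) : Good 1 m (fans m) where
  distinct := distinctInBlocks_fans m
  profile := by
    intro a
    by_cases h : a ∈ text (fans m)
    · obtain ⟨h1, h2⟩ := mem_text_fans h
      right
      rw [fans, profile_map_fan h1 h2, if_pos (by omega), if_pos (by omega)]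
      rfl
    · exact Or.inl (profile_eq_nil_iff.2 h)
  avoids := avoidsAlternation_fans m
  length_special := fun _ _ _ h => length_special_fans h

/-! ### The sequences `G_d(m)` -/

theorem blocks_replicate_plain (n : ℕ) (b : List ℕ) :
    blocks (List.replicate n (.plain b)) = List.replicate n b := by
  induction n with
  | zero => rfl
  | succ n ih => rw [List.replicate_succ, blocks_plain, ih, List.replicate_succ]

theorem profile_replicate_plain (n a : ℕ) : profile a (List.replicate n (.plain [a])) =
    List.replicate n false := by
  induction n with
  | zero => rfl
  | succ n ih => simp [List.replicate_succ, profile, ih]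

theorem text_constant {d x : ℕ} (h : x ∈ text (constant d)) : x = 0 := by
  simp only [text, constant, blocks_triple, blocks_append, blocks_replicate_plain] at h
  simp only [List.flatten_cons, List.flatten_append, List.mem_append, List.mem_flatten,
    List.mem_replicate, List.mem_cons, List.not_mem_nil, blocks_nil, List.flatten_nil, or_false,
    false_or] at h
  rcases h with h | h | ⟨l, ⟨-, rfl⟩, h⟩ | h | h
  exacts [h, h, by simpa using h, h, h]

theorem good_constant (d : ℕ) : Good (d + 1) 1 (constant (d + 1)) where
  distinct := by
    intro b hb
    simp only [constant, blocks_triple, blocks_append, blocks_replicate_plain, blocks_nil,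
      List.mem_cons, List.mem_append, List.mem_replicate, List.not_mem_nil, or_false] at hb
    rcases hb with rfl | rfl | rfl | ⟨-, rfl⟩ | rfl | rfl | rfl <;> simp
  profile := by
    intro a
    by_cases ha : a = 0
    · subst ha
      right
      have h : 2 * (d + 1) - 2 = 2 * d := by omega
      -- The regular blocks `[0]` beside the two special ones provide two of the regular
      -- occurrences.
      have h2 : List.replicate (2 * (d + 1)) false =
          false :: (List.replicate (2 * d) false ++ [false]) := by
        rw [show [false] = List.replicate 1 false from rfl, ← List.replicate_add,
          ← List.replicate_succ]
        rfl
      rw [constant, h, h2]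
      simp [profile, profile_append, profile_replicate_plain]
    · exact Or.inl (profile_eq_nil_iff.2 fun h => ha (text_constant h))
  avoids := by
    intro a b hab h
    obtain ⟨ha, hb⟩ := mem_of_alternation_sublist h
    exact hab ((text_constant ha).trans (text_constant hb).symm)
  length_special := by
    intro l s r h
    simp only [constant, List.mem_cons, List.mem_append, List.mem_replicate, reduceCtorEq,
      and_false, List.not_mem_nil, or_false, false_or, Segment.triple.injEq] at h
    rcases h with ⟨-, rfl, -⟩ | ⟨-, rfl, -⟩ <;> rfl

theorem G_one (m : ℕ) : G 1 m = fans m := by rw [G]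

theorem G_add_two_one (d : ℕ) : G (d + 2) 1 = constant (d + 2) := by rw [G]

theorem G_add_two_add_two (d m : ℕ) : G (d + 2) (m + 2) =
    substitute (G (d + 2) (m + 1)) 0 []
      ((G (d + 1) (numSpecial (G (d + 2) (m + 1)))).map (Segment.rename (Nat.pair 0))) := by
  rw [G]

theorem numSpecial_map_fan (m n : ℕ) : numSpecial ((List.range n).map (fan m)) = n := by
  induction n with
  | zero => rfl
  | succ n ih =>
    rw [List.range_succ, List.map_append, numSpecial_append, ih, List.map_cons, fan_eq]; rfl

theorem numSpecial_replicate_plain (n : ℕ) (b : List ℕ) :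
    numSpecial (List.replicate n (.plain b)) = 0 := by
  induction n with
  | zero => rfl
  | succ n ih => simpa [List.replicate_succ, numSpecial] using ih

theorem numSpecial_G_one (m : ℕ) : numSpecial (G 1 m) = m + 1 := by
  rw [G_one, fans, numSpecial_map_fan]

theorem numSpecial_G_add_two_one (d : ℕ) : numSpecial (G (d + 2) 1) = 2 := by
  simp [G_add_two_one, constant, numSpecial, numSpecial_replicate_plain]

theorem numSpecial_G_add_two_add_two (d m : ℕ) : numSpecial (G (d + 2) (m + 2)) =
    numSpecial (G (d + 1) (numSpecial (G (d + 2) (m + 1)))) * numSpecial (G (d + 2) (m + 1)) := by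
  rw [G_add_two_add_two, numSpecial_substitute, numSpecial_map_rename]

theorem numSpecial_G_pos (d m : ℕ) : 1 ≤ numSpecial (G (d + 1) (m + 1)) := by
  induction d generalizing m with
  | zero => rw [numSpecial_G_one]; omega
  | succ d ihd =>
    induction m with
    | zero => rw [numSpecial_G_add_two_one]; omega
    | succ m ih =>
      rw [numSpecial_G_add_two_add_two]
      obtain ⟨k, hk⟩ := Nat.exists_eq_succ_of_ne_zero (Nat.pos_iff_ne_zero.1 ih)
      have := ihd k
      rw [← Nat.succ_eq_add_one k, ← hk] at this
      exact Nat.mul_pos this ih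

theorem good_G (d m : ℕ) : Good (d + 1) (m + 1) (G (d + 1) (m + 1)) := by
  induction d generalizing m with
  | zero => rw [G_one]; exact good_fans _
  | succ d ihd =>
    induction m with
    | zero => rw [G_add_two_one]; exact good_constant _
    | succ m ih =>
      rw [G_add_two_add_two]
      refine ih.substitute ?_
      obtain ⟨k, hk⟩ := Nat.exists_eq_succ_of_ne_zero
        (Nat.pos_iff_ne_zero.1 (numSpecial_G_pos (d + 1) m))
      rw [hk]
      exact ihd k

theorem Good.count_eq {d m : ℕ} {X : List Segment} (h : Good d m X) {a : ℕ} (ha : a ∈ text X) :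
    (text X).count a = 2 * d + 2 := by
  rw [← length_profile, (h.profile a).resolve_left fun h' => profile_eq_nil_iff.1 h' ha]
  simp

/-! ### The numbers of blocks and of letters of `G_d(m)` -/

theorem length_blocks_map_fan (m n : ℕ) :
    (blocks ((List.range n).map (fan m))).length = 3 * n := by
  induction n with
  | zero => rfl
  | succ n ih =>
    rw [List.range_succ, List.map_append, blocks_append, List.length_append, ih, List.map_cons,
      fan_eq]
    simp
    ring

theorem length_blocks_G_one (m : ℕ) : (blocks (G 1 m)).length = 3 * (m + 1) := by
  rw [G_one, fans, length_blocks_map_fan]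

theorem length_blocks_G_add_two_one (d : ℕ) : (blocks (G (d + 2) 1)).length = 2 * d + 8 := by
  rw [G_add_two_one]
  simp [constant, blocks_replicate_plain]
  omega

theorem length_blocks_G_add_two_add_two (d m : ℕ) :
    (blocks (G (d + 2) (m + 2))).length +
        numSpecial (G (d + 1) (numSpecial (G (d + 2) (m + 1)))) =
      (blocks (G (d + 1) (numSpecial (G (d + 2) (m + 1))))).length +
        numSpecial (G (d + 1) (numSpecial (G (d + 2) (m + 1)))) *
          (blocks (G (d + 2) (m + 1))).length := by
  have h := length_blocks_substitute (G (d + 2) (m + 1))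
    ((G (d + 1) (numSpecial (G (d + 2) (m + 1)))).map (Segment.rename (Nat.pair 0))) 0 []
  rwa [numSpecial_map_rename, blocks_map_rename, List.length_map, ← G_add_two_add_two] at h

theorem add_two_le_numSpecial_G (d m : ℕ) : m + 2 ≤ numSpecial (G (d + 1) (m + 1)) := by
  induction d generalizing m with
  | zero => rw [numSpecial_G_one]
  | succ d ihd =>
    induction m with
    | zero => rw [numSpecial_G_add_two_one]
    | succ m ih =>
      rw [numSpecial_G_add_two_add_two]
      obtain ⟨k, hk⟩ := Nat.exists_eq_add_of_le' (show 1 ≤ numSpecial (G (d + 1 + 1) (m + 1)) by omega)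
      have h1 := ihd k
      rw [← hk] at h1
      have h2 := Nat.mul_le_mul (show 2 ≤ _ by exact (Nat.le_add_left 2 k).trans h1) ih
      rw [show d + 2 = d + 1 + 1 from rfl]
      omega

theorem numSpecial_le_length_blocks (X : List Segment) : numSpecial X ≤ (blocks X).length := by
  induction X with
  | nil => simp [numSpecial]
  | cons S X ih => cases S <;> simp [numSpecial] <;> omega

/-- The slack `6 * (d + 1)` carries the induction: multiplied by the number `y ≥ 3` of copies, it
pays for the blocks of `Y` and for itself. -/
theorem length_blocks_G_add_le (d m : ℕ)
    (hY : ∀ m, (blocks (G (d + 1) (m + 1))).length ≤ 4 * (d + 1) * numSpecial (G (d + 1) (m + 1))) :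
    (blocks (G (d + 2) (m + 2))).length + 6 * (d + 1) ≤
      4 * (d + 2) * numSpecial (G (d + 2) (m + 2)) := by
  have hstep : ∀ m, 3 ≤ numSpecial (G (d + 1) (numSpecial (G (d + 2) (m + 1)))) ∧
      (blocks (G (d + 1) (numSpecial (G (d + 2) (m + 1))))).length ≤
        4 * (d + 1) * numSpecial (G (d + 1) (numSpecial (G (d + 2) (m + 1)))) := by
    intro m
    obtain ⟨k, hk⟩ := Nat.exists_eq_add_of_le'
      ((Nat.le_add_left 2 m).trans (add_two_le_numSpecial_G (d + 1) m))
    rw [hk]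
    exact ⟨(by omega : 3 ≤ (k + 1) + 2).trans (add_two_le_numSpecial_G d (k + 1)), hY (k + 1)⟩
  induction m with
  | zero =>
    have h := length_blocks_G_add_two_add_two d 0
    obtain ⟨h3, hb⟩ := hstep 0
    rw [numSpecial_G_add_two_add_two]
    rw [zero_add, length_blocks_G_add_two_one] at *
    rw [numSpecial_G_add_two_one] at *
    generalize numSpecial (G (d + 1) 2) = y at *
    nlinarith
  | succ m ih =>
    have h := length_blocks_G_add_two_add_two d (m + 1)
    obtain ⟨h3, hb⟩ := hstep (m + 1)
    rw [numSpecial_G_add_two_add_two]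
    rw [show m + 1 + 1 = m + 2 from rfl] at *
    generalize numSpecial (G (d + 2) (m + 2)) = F at *
    generalize numSpecial (G (d + 1) F) = y at *
    generalize (blocks (G (d + 2) (m + 2))).length = x at *
    have h4 := Nat.mul_le_mul_left y ih
    nlinarith

theorem length_blocks_G_le (d m : ℕ) :
    (blocks (G (d + 1) (m + 1))).length ≤ 4 * (d + 1) * numSpecial (G (d + 1) (m + 1)) := by
  induction d generalizing m with
  | zero => rw [length_blocks_G_one, numSpecial_G_one]; omega
  | succ d ih =>
    cases m with
    | zero => rw [length_blocks_G_add_two_one, numSpecial_G_add_two_one]; omega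
    | succ m => exact (Nat.le_add_right _ _).trans (length_blocks_G_add_le d m ih)

/-- The concatenation of the special blocks. -/
def specialText : List Segment → List ℕ
  | [] => []
  | .plain _ :: X => specialText X
  | .triple _ s _ :: X => s ++ specialText X

theorem count_specialText (a : ℕ) (X : List Segment) :
    (specialText X).count a = (profile a X).count true := by
  induction X with
  | nil => rfl
  | cons S X ih => cases S <;> simp [specialText, profile, ih, List.count_replicate]

theorem length_specialText {X : List Segment} {m : ℕ}
    (hX : ∀ l s r, Segment.triple l s r ∈ X → s.length = m) :
    (specialText X).length = numSpecial X * m := by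
  induction X with
  | nil => simp [specialText, numSpecial]
  | cons S X ih =>
    have h := ih fun l s r h => hX l s r (by simp [h])
    cases S with
    | plain b => simpa [specialText, numSpecial] using h
    | triple l s r =>
      rw [specialText, List.length_append, h, hX l s r (by simp), numSpecial]
      ring

theorem specialText_subset (X : List Segment) : specialText X ⊆ text X := by
  induction X with
  | nil => simp [specialText]
  | cons S X ih =>
    intro x hx
    cases S with
    | plain b => simp [ih hx]
    | triple l s r =>
      rcases List.mem_append.1 hx with h | h
      · simp [h]
      · simp [ih h]

/-- Count the positions in special blocks; every letter fills at most two of them. -/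
theorem Good.numSpecial_mul_le {d m : ℕ} {X : List Segment} (h : Good d m X) :
    numSpecial X * m ≤ 2 * (text X).toFinset.card := by
  rw [← length_specialText h.length_special, ← List.sum_toFinset_count_eq_length]
  calc ∑ a ∈ (specialText X).toFinset, (specialText X).count a
      ≤ ∑ a ∈ (specialText X).toFinset, 2 := by
        refine Finset.sum_le_sum fun a _ => ?_
        rw [count_specialText]
        rcases h.profile a with h | h <;> simp [h, List.count_replicate]
    _ = 2 * (specialText X).toFinset.card := by rw [Finset.sum_const, smul_eq_mul, mul_comm]
    _ ≤ 2 * (text X).toFinset.card := by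
        refine Nat.mul_le_mul_left 2 (Finset.card_le_card fun a ha => ?_)
        exact List.mem_toFinset.2 (specialText_subset X (List.mem_toFinset.1 ha))

/-! ### Disjoint copies -/

theorem AvoidsAlternation.append {v w : List ℕ} (hv : AvoidsAlternation 5 v)
    (hw : AvoidsAlternation 5 w) (hvw : List.Disjoint v w) : AvoidsAlternation 5 (v ++ w) := by
  intro a b hab h
  by_cases h' : ∀ u ∈ [v, w], a ∉ u ∨ b ∉ u
  · exact not_alternation_sublist (L := [v, w]) (by simp) h' (by simp) h
  · push Not at h'
    obtain ⟨u, hu, ha, hb⟩ := h'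
    simp only [List.mem_cons, List.not_mem_nil, or_false] at hu
    have hf := h.filter fun x => decide (x = a ∨ x = b)
    rw [List.filter_eq_self.2 (by simp [alternation]), List.filter_append] at hf
    rcases hu with rfl | rfl
    · have hnil : w.filter (fun x => decide (x = a ∨ x = b)) = [] := by
        rw [List.filter_eq_nil_iff]
        rintro x hx hxab
        rcases of_decide_eq_true hxab with rfl | rfl
        exacts [hvw ha hx, hvw hb hx]
      rw [hnil, List.append_nil] at hf
      exact hv a b hab (hf.trans List.filter_sublist)
    · have hnil : v.filter (fun x => decide (x = a ∨ x = b)) = [] := by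
        rw [List.filter_eq_nil_iff]
        rintro x hx hxab
        rcases of_decide_eq_true hxab with rfl | rfl
        exacts [hvw hx ha, hvw hx hb]
      rw [hnil, List.nil_append] at hf
      exact hw a b hab (hf.trans List.filter_sublist)

theorem Admissible.append {k m n : ℕ} {B C : List (List ℕ)} (hB : Admissible 5 k m B)
    (hC : Admissible 5 k n C) (hBC : List.Disjoint B.flatten C.flatten) :
    Admissible 5 k (m + n) (B ++ C) where
  length_eq := by rw [List.length_append, hB.length_eq, hC.length_eq]
  distinct := fun b hb => (List.mem_append.1 hb).elim (hB.distinct b) (hC.distinct b)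
  occurrences := by
    intro a ha
    rw [List.flatten_append, List.mem_append] at ha
    rw [List.flatten_append, List.count_append]
    rcases ha with ha | ha
    · exact (hB.occurrences a ha).trans (Nat.le_add_right _ _)
    · exact (hC.occurrences a ha).trans (Nat.le_add_left _ _)
  avoids := by
    rw [List.flatten_append]
    exact hB.avoids.append hC.avoids hBC

theorem Admissible.map {k m : ℕ} {B : List (List ℕ)} {f : ℕ → ℕ} (hf : Function.Injective f)
    (hB : Admissible 5 k m B) : Admissible 5 k m (B.map (List.map f)) where
  length_eq := by rw [List.length_map, hB.length_eq]
  distinct := by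
    intro b hb
    obtain ⟨c, hc, rfl⟩ := List.mem_map.1 hb
    exact (hB.distinct c hc).map hf
  occurrences := by
    intro a ha
    rw [← List.map_flatten] at ha ⊢
    obtain ⟨x, hx, rfl⟩ := List.mem_map.1 ha
    rw [List.count_map_of_injective _ f hf]
    exact hB.occurrences x hx
  avoids := by
    rw [← List.map_flatten]
    exact hB.avoids.map hf

theorem admissible_replicate_nil (k n : ℕ) : Admissible 5 k n (List.replicate n []) where
  length_eq := by simp
  distinct := fun b hb => by rw [(List.mem_replicate.1 hb).2]; exact List.nodup_nil
  occurrences := by simp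
  avoids := fun a b _ h => by simpa using mem_of_alternation_sublist h

/-- The first component of `Nat.unpair` records the number of the copy, which keeps the alphabets
disjoint. -/
theorem Admissible.exists_copies {k n : ℕ} {B : List (List ℕ)} (hB : Admissible 5 k n B) (q : ℕ) :
    ∃ C, Admissible 5 k (q * n) C ∧ C.flatten.toFinset.card = q * B.flatten.toFinset.card ∧
      ∀ x ∈ C.flatten, x.unpair.1 < q := by
  induction q with
  | zero => exact ⟨[], by simpa using admissible_replicate_nil k 0, by simp, by simp⟩
  | succ q ih =>
    obtain ⟨C, hC, hcard, hlt⟩ := ih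
    have hmem : ∀ x ∈ (B.map (List.map (Nat.pair q))).flatten, x.unpair.1 = q := by
      intro x hx
      rw [← List.map_flatten] at hx
      obtain ⟨y, -, rfl⟩ := List.mem_map.1 hx
      simp
    have hdisj : List.Disjoint C.flatten (B.map (List.map (Nat.pair q))).flatten :=
      fun x hx hx' => (hlt x hx).ne (hmem x hx')
    refine ⟨C ++ B.map (List.map (Nat.pair q)), ?_, ?_, fun x hx => ?_⟩
    · rw [Nat.succ_mul]
      exact hC.append (hB.map (pair_left_injective q)) hdisj
    · rw [List.flatten_append, List.toFinset_append, Finset.card_union_of_disjoint, hcard,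
        ← List.map_flatten, Nat.succ_mul]
      · congr 1
        have himage : (B.flatten.map (Nat.pair q)).toFinset =
            B.flatten.toFinset.image (Nat.pair q) := by
          ext; simp only [List.mem_toFinset, List.mem_map, Finset.mem_image]
        rw [himage, Finset.card_image_of_injective _ (pair_left_injective q)]
      · rw [List.disjoint_toFinset_iff_disjoint]
        exact hdisj
    · rw [List.flatten_append, List.mem_append] at hx
      rcases hx with hx | hx
      · exact (hlt x hx).trans (Nat.lt_succ_self q)
      · rw [hmem x hx]; exact Nat.lt_succ_self q

theorem Admissible.mul_card_le_maxLetters {k n q M : ℕ} {B : List (List ℕ)}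
    (hB : Admissible 5 k n B) (hM : q * n ≤ M) :
    ((q * B.flatten.toFinset.card : ℕ) : ℕ∞) ≤ maxLetters 5 k M := by
  obtain ⟨C, hC, hcard, -⟩ := hB.exists_copies q
  have hD := hC.append (admissible_replicate_nil k (M - q * n)) (by simp)
  rw [Nat.add_sub_cancel' hM] at hD
  rw [← hcard]
  have := le_iSup₂ (f := fun (B : List (List ℕ)) (_ : Admissible 5 k M B) =>
    (B.flatten.toFinset.card : ℕ∞)) _ hD
  simpa [maxLetters] using this

theorem exists_le_maxLetters {d m M : ℕ} (hM : (blocks (G (d + 1) (m + 1))).length ≤ M) :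
    ∃ N : ℕ, (N : ℕ∞) ≤ maxLetters 5 (2 * (d + 1) + 2) M ∧ M * (m + 1) ≤ 16 * (d + 1) * N := by
  have hG := good_G d m
  have hadm : Admissible 5 (2 * (d + 1) + 2) _ (blocks (G (d + 1) (m + 1))) :=
    ⟨rfl, hG.distinct, fun a ha => (hG.count_eq ha).ge, hG.avoids⟩
  have hlen := length_blocks_G_le d m
  have hcard := hG.numSpecial_mul_le
  have hpos : 1 ≤ (blocks (G (d + 1) (m + 1))).length :=
    (numSpecial_G_pos d m).trans (numSpecial_le_length_blocks _)
  rw [text] at hcard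
  generalize (blocks (G (d + 1) (m + 1))).length = b at *
  generalize numSpecial (G (d + 1) (m + 1)) = f at *
  -- Take `M / b` copies and pad with empty blocks. Since `b ≤ M`, rounding loses at most a factor
  -- 2.
  refine ⟨_, hadm.mul_card_le_maxLetters (Nat.div_mul_le_self M b), ?_⟩
  have hq : 1 ≤ M / b := (Nat.one_le_div_iff hpos).2 hM
  have hlt : M < (M / b + 1) * b := by
    rw [mul_comm]; exact Nat.lt_mul_div_succ M hpos
  generalize (blocks (G (d + 1) (m + 1))).flatten.toFinset.card = N at *
  generalize M / b = q at *
  calc M * (m + 1) ≤ ((q + q) * b) * (m + 1) := by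
        gcongr
        exact hlt.le.trans (by gcongr)
    _ ≤ ((q + q) * (4 * (d + 1) * f)) * (m + 1) := by gcongr
    _ = 8 * (d + 1) * q * (f * (m + 1)) := by ring
    _ ≤ 8 * (d + 1) * q * (2 * N) := by gcongr
    _ = 16 * (d + 1) * (q * N) := by ring

/-! ### Growth of the number of special blocks -/

/-- Constant factors can thus be absorbed by shifting the argument of the hierarchy. -/
theorem two_mul_hier_le (k n : ℕ) : 2 * hier (k + 2) n ≤ hier (k + 2) (n + 1) := by
  induction k generalizing n with
  | zero => rw [hier_succ, hier_one]
  | succ k ih =>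
    have h : ∀ z, 2 ^ z ≤ hier (k + 2) z := by
      intro z
      induction z with
      | zero => rw [hier_zero, pow_zero]
      | succ z ihz => rw [pow_succ']; exact (Nat.mul_le_mul_left 2 ihz).trans (ih z)
    rw [hier_succ]
    refine le_trans ?_ (h _)
    generalize hier (k + 1 + 2) n = z
    cases z with
    | zero => simp
    | succ z => rw [pow_succ']; exact Nat.mul_le_mul_left 2 Nat.lt_two_pow_self

theorem two_pow_mul_hier_le (k n j : ℕ) : 2 ^ j * hier (k + 2) n ≤ hier (k + 2) (n + j) := by
  induction j with
  | zero => simp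
  | succ j ih =>
    calc 2 ^ (j + 1) * hier (k + 2) n = 2 * (2 ^ j * hier (k + 2) n) := by ring
      _ ≤ 2 * hier (k + 2) (n + j) := Nat.mul_le_mul_left 2 ih
      _ ≤ hier (k + 2) (n + (j + 1)) := two_mul_hier_le k (n + j)

theorem two_pow_le_hier (k j : ℕ) : 2 ^ j ≤ hier (k + 2) j := by
  simpa [hier_zero] using two_pow_mul_hier_le k 0 j

theorem hier_apply_one (k : ℕ) : hier (k + 1) 1 = 2 := by
  induction k with
  | zero => rw [hier_one]
  | succ k ih => rw [hier_succ k 0, hier_zero, ih]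

/-- The numbers `f` of special blocks satisfy `f ↦ (f + 1) * f`, nearly squaring. The factor `m + 2`
leaves enough room for the `+ 1`. -/
theorem mul_numSpecial_G_two_le (m : ℕ) :
    (m + 2) * numSpecial (G 2 (m + 2)) ≤ 2 ^ 2 ^ (m + 2) ∧ 6 ≤ numSpecial (G 2 (m + 2)) := by
  have h : ∀ m, numSpecial (G 2 (m + 2)) =
      (numSpecial (G 2 (m + 1)) + 1) * numSpecial (G 2 (m + 1)) := fun m => by
    rw [numSpecial_G_add_two_add_two 0 m, numSpecial_G_one]
  induction m with
  | zero => rw [h 0, zero_add, numSpecial_G_add_two_one 0]; norm_num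
  | succ m ih =>
    have h1 := h (m + 1)
    rw [show m + 1 + 1 = m + 2 from rfl] at h1
    rw [h1]
    obtain ⟨ih1, ih2⟩ := ih
    generalize numSpecial (G 2 (m + 2)) = f at *
    refine ⟨?_, by nlinarith⟩
    have h2 : (m + 1 + 2) * (f + 1) ≤ (m + 2) * (m + 2) * f := by
      obtain ⟨e, rfl⟩ := Nat.exists_eq_add_of_le ih2
      nlinarith [Nat.zero_le (m * e), Nat.zero_le (m * m * e), Nat.zero_le (m * m)]
    calc (m + 1 + 2) * ((f + 1) * f) = ((m + 1 + 2) * (f + 1)) * f := by ring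
      _ ≤ ((m + 2) * (m + 2) * f) * f := by gcongr
      _ = ((m + 2) * f) * ((m + 2) * f) := by ring
      _ ≤ 2 ^ 2 ^ (m + 2) * 2 ^ 2 ^ (m + 2) := by gcongr
      _ = 2 ^ 2 ^ (m + 1 + 2) := by rw [← pow_add]; congr 1; ring

/-- If `f` is the number of special blocks so far, the next one is `f` times that of `G_{k+2}(f)`.
By `hk` this is at most two applications of level `k + 2`, that is, two steps of the argument at
level `k + 3`. -/
theorem numSpecial_G_le_hier_of {k : ℕ}
    (hk : ∀ x, (x + 1) * numSpecial (G (k + 2) (x + 1)) ≤ hier (k + 2) (hier (k + 2) (x + 1)))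
    (m : ℕ) : numSpecial (G (k + 3) (m + 1)) ≤ hier (k + 3) (2 * m + 1) := by
  induction m with
  | zero => rw [numSpecial_G_add_two_one (k + 1), hier_apply_one]
  | succ m ih =>
    rw [numSpecial_G_add_two_add_two (k + 1) m, mul_comm]
    obtain ⟨x, hx⟩ := Nat.exists_eq_add_of_le' (numSpecial_G_pos (k + 2) m)
    rw [show k + 1 + 2 = k + 2 + 1 from rfl, show 2 * (m + 1) + 1 = 2 * m + 1 + 1 + 1 by ring,
      show k + 2 + 1 = k + 1 + 2 from rfl, hier_succ, hier_succ]
    rw [show k + 2 + 1 = k + 1 + 2 from rfl] at hx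
    rw [show k + 3 = k + 1 + 2 from rfl, hx] at ih
    rw [hx]
    refine (hk x).trans ?_
    have hmono := (hier_strictMono (k + 1)).monotone
    exact hmono (hmono ih)

theorem mul_numSpecial_G_le (k x : ℕ) :
    (x + 1) * numSpecial (G (k + 2) (x + 1)) ≤ hier (k + 2) (hier (k + 2) (x + 1)) := by
  induction k generalizing x with
  | zero =>
    rw [zero_add, hier_two, hier_two]
    cases x with
    | zero => rw [zero_add, numSpecial_G_add_two_one 0]; norm_num
    | succ x => exact (mul_numSpecial_G_two_le x).1
  | succ k ih =>
    have h1 := numSpecial_G_le_hier_of ih x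
    have h2 : x + 1 ≤ 2 ^ x := Nat.lt_two_pow_self
    -- This is `3 * x + 1 ≤ 2 ^ (x + 1)`, with equality at `x = 1`.
    have h3 : 2 * x + 1 + x ≤ hier (k + 1 + 2) (x + 1) := by
      refine le_trans ?_ (two_pow_le_hier (k + 1) (x + 1))
      clear h1 h2
      induction x with
      | zero => norm_num
      | succ x ih =>
        have : 1 ≤ 2 ^ x := Nat.one_le_two_pow
        rcases Nat.eq_zero_or_pos x with rfl | hx
        · norm_num
        · have : 2 ≤ 2 ^ x := by
            simpa using Nat.pow_le_pow_right (show 1 ≤ 2 by omega) hx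
          rw [pow_succ, pow_succ] at *
          omega
    calc (x + 1) * numSpecial (G (k + 1 + 2) (x + 1))
        ≤ 2 ^ x * hier (k + 1 + 2) (2 * x + 1) := Nat.mul_le_mul h2 h1
      _ ≤ hier (k + 1 + 2) (2 * x + 1 + x) := two_pow_mul_hier_le _ _ _
      _ ≤ hier (k + 1 + 2) (hier (k + 1 + 2) (x + 1)) := (hier_strictMono (k + 2)).monotone h3

theorem numSpecial_G_le_hier (k m : ℕ) :
    numSpecial (G (k + 3) (m + 1)) ≤ hier (k + 3) (2 * m + 1) :=
  numSpecial_G_le_hier_of (mul_numSpecial_G_le k) m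

/-! ### Lower bounds -/

/-- Every large `M` lies between the lengths of two consecutive sequences, with index as large as
desired. -/
theorem eventually_exists_length_blocks (d K : ℕ) : ∀ᶠ M : ℕ in atTop, ∃ m, K ≤ m ∧
    (blocks (G (d + 1) (m + 1))).length ≤ M ∧ M < (blocks (G (d + 1) (m + 2))).length := by
  have h : ∀ᶠ M : ℕ in atTop, ∀ p ∈ Finset.range (K + 1),
      (blocks (G (d + 1) (p + 1))).length ≤ M :=
    (Filter.eventually_all_finset _).2 fun p _ => eventually_ge_atTop _
  filter_upwards [h] with M hM
  classical
  have hex : ∃ p, M < (blocks (G (d + 1) (p + 1))).length :=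
    ⟨M, by
      have h1 := add_two_le_numSpecial_G d M
      have h2 := numSpecial_le_length_blocks (G (d + 1) (M + 1))
      omega⟩
  have hK : K + 1 ≤ Nat.find hex := by
    by_contra hlt
    exact absurd (Nat.find_spec hex) (not_lt.2 (hM _ (Finset.mem_range.2 (not_le.1 hlt))))
  obtain ⟨m, hm⟩ := Nat.exists_eq_add_of_le' ((Nat.le_add_left 1 K).trans hK)
  refine ⟨m, by omega, not_lt.1 (Nat.find_min hex (by omega)), ?_⟩
  have := Nat.find_spec hex
  rwa [hm] at this

theorem ofReal_le_maxLetters {k M N : ℕ} {x : ℝ} (h : (N : ℕ∞) ≤ maxLetters 5 k M)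
    (hx : x ≤ N) : ENNReal.ofReal x ≤ (maxLetters 5 k M : ℝ≥0∞) := by
  refine (ENNReal.ofReal_le_ofReal hx).trans ?_
  rw [ENNReal.ofReal_natCast, ← ENat.toENNReal_coe]
  exact ENat.toENNReal_le.2 h

theorem maxLetters_lower : ∃ c : ℝ, 0 < c ∧ ∀ d : ℕ, 3 ≤ d → ∀ᶠ m : ℕ in atTop,
    ENNReal.ofReal (c * (1 / d * m * invHier d m)) ≤ (maxLetters 5 (2 * d + 2) m : ℝ≥0∞) := by
  refine ⟨1 / 48, by norm_num, fun d hd => ?_⟩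
  obtain ⟨k, rfl⟩ := Nat.exists_eq_add_of_le' hd
  filter_upwards [eventually_exists_length_blocks (k + 2) (4 * (k + 3))] with M hM
  obtain ⟨m, hKm, hle, hlt⟩ := hM
  obtain ⟨N, hN, hMN⟩ := exists_le_maxLetters hle
  refine ofReal_le_maxLetters hN ?_
  -- The next sequence is longer than `M`. The factor `4 * (k + 3)` is below `2 ^ (4 * (k + 3))` and
  -- shifts the argument by `4 * (k + 3) ≤ m`; only here must `M` be large depending on `d`. The
  -- factor 3 and the 16 of `exists_le_maxLetters` make 48.
  have hinv : invHier (k + 3) M ≤ 3 * (m + 1) := by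
    refine (invHier_le (n := 2 * (m + 1) + 1 + 4 * (k + 3)) ?_).trans (by omega)
    calc M ≤ 4 * (k + 3) * numSpecial (G (k + 3) (m + 2)) :=
          hlt.le.trans (length_blocks_G_le (k + 2) (m + 1))
      _ ≤ 2 ^ (4 * (k + 3)) * hier (k + 3) (2 * (m + 1) + 1) :=
          Nat.mul_le_mul Nat.lt_two_pow_self.le (numSpecial_G_le_hier k (m + 1))
      _ ≤ hier (k + 3) (2 * (m + 1) + 1 + 4 * (k + 3)) := two_pow_mul_hier_le (k + 1) _ _
  have h1 : M * invHier (k + 3) M ≤ 48 * (k + 3) * N := by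
    calc M * invHier (k + 3) M ≤ M * (3 * (m + 1)) := Nat.mul_le_mul_left M hinv
      _ = 3 * (M * (m + 1)) := by ring
      _ ≤ 3 * (16 * (k + 2 + 1) * N) := Nat.mul_le_mul_left 3 hMN
      _ = 48 * (k + 3) * N := by ring
  have h2 : (M : ℝ) * invHier (k + 3) M ≤ 48 * ((k + 3 : ℕ) : ℝ) * N := by exact_mod_cast h1
  have h3 : (0 : ℝ) < ((k + 3 : ℕ) : ℝ) := by positivity
  calc (1 / 48 : ℝ) * (1 / ((k + 3 : ℕ) : ℝ) * M * invHier (k + 3) M)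
      = M * invHier (k + 3) M / (48 * ((k + 3 : ℕ) : ℝ)) := by field_simp
    _ ≤ N := by
      rw [div_le_iff₀ (by positivity)]
      linarith

theorem maxLetters_six_lower : ∃ c : ℝ, 0 < c ∧ ∀ᶠ m : ℕ in atTop,
    ENNReal.ofReal (c * (m * Real.log (Real.log m))) ≤ (maxLetters 5 6 m : ℝ≥0∞) := by
  refine ⟨1 / 128, by norm_num, ?_⟩
  filter_upwards [eventually_exists_length_blocks 1 0, eventually_ge_atTop 2] with M hM hM2
  obtain ⟨m, -, hle, hlt⟩ := hM
  obtain ⟨N, hN, hMN⟩ := exists_le_maxLetters hle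
  refine ofReal_le_maxLetters hN ?_
  have hupper : M ≤ 2 ^ 2 ^ (m + 4) := by
    have h1 := (mul_numSpecial_G_two_le m).1
    have h2 : numSpecial (G 2 (m + 2)) ≤ 2 ^ 2 ^ (m + 2) :=
      (Nat.le_mul_of_pos_left _ (by omega)).trans h1
    have h3 : 3 + 2 ^ (m + 2) ≤ 2 ^ (m + 4) := by
      have : 1 ≤ 2 ^ m := Nat.one_le_two_pow
      rw [pow_add, pow_add]; omega
    calc M ≤ 8 * numSpecial (G 2 (m + 2)) := hlt.le.trans (length_blocks_G_le 1 (m + 1))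
      _ ≤ 2 ^ 3 * 2 ^ 2 ^ (m + 2) := Nat.mul_le_mul_left 8 h2
      _ = 2 ^ (3 + 2 ^ (m + 2)) := (pow_add 2 3 _).symm
      _ ≤ 2 ^ 2 ^ (m + 4) := Nat.pow_le_pow_right (by omega) h3
  have hM2' : (2 : ℝ) ≤ M := by exact_mod_cast hM2
  have hupper' : (M : ℝ) ≤ 2 ^ 2 ^ (m + 4) := by exact_mod_cast hupper
  have hlog2 : Real.log 2 ≤ 1 := by linarith [Real.log_two_lt_d9]
  have hlog : Real.log M ≤ 2 ^ (m + 4) := by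
    have := Real.log_le_log (by linarith) hupper'
    rw [Real.log_pow] at this
    push_cast at this
    exact this.trans (mul_le_of_le_one_right (by positivity) hlog2)
  -- From `m + 4 ≤ 4 * (m + 1)`. Together with the factor 32 for `d = 2`, this gives 128.
  have hloglog : Real.log (Real.log M) ≤ 4 * (m + 1) := by
    have := Real.log_le_log (Real.log_pos (by linarith)) hlog
    rw [Real.log_pow] at this
    push_cast at this
    have h := mul_le_of_le_one_right (a := (m + 4 : ℝ)) (by positivity) hlog2
    have hm : (0 : ℝ) ≤ m := Nat.cast_nonneg m
    linarith
  have h1 : (M : ℝ) * (m + 1) ≤ 32 * N := by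
    have : M * (m + 1) ≤ 32 * N := hMN.trans (by ring_nf; rfl)
    exact_mod_cast this
  have h2 := mul_le_mul_of_nonneg_left hloglog (show (0 : ℝ) ≤ M by linarith)
  linarith

end BlockSeq

theorem mainTheorem3 :
    -- every `G_d(m)` is a sequence of blocks of distinct letters without alternation `ababa`
    -- in which every letter occurs exactly `2d + 2` times
    (∀ d m : ℕ, 1 ≤ d → 1 ≤ m →
      BlockSeq.DistinctInBlocks (BlockSeq.blocks (BlockSeq.G d m)) ∧
      (∀ a ∈ (BlockSeq.blocks (BlockSeq.G d m)).flatten,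
        (BlockSeq.blocks (BlockSeq.G d m)).flatten.count a = 2 * d + 2) ∧
      BlockSeq.AvoidsAlternation 5 (BlockSeq.blocks (BlockSeq.G d m)).flatten) ∧
    -- lower bounds
    (∃ c : ℝ, 0 < c ∧ ∀ᶠ m : ℕ in atTop,
      ENNReal.ofReal (c * (m * Real.log (Real.log m))) ≤ (BlockSeq.maxLetters 5 6 m : ℝ≥0∞)) ∧
    (∃ c : ℝ, 0 < c ∧ ∀ d : ℕ, 3 ≤ d → ∀ᶠ m : ℕ in atTop,
      ENNReal.ofReal (c * (1 / d * m * BlockSeq.invHier d m)) ≤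
        (BlockSeq.maxLetters 5 (2 * d + 2) m : ℝ≥0∞)) ∧
    -- matching upper bounds
    (∃ C : ℝ, 0 < C ∧ ∀ᶠ m : ℕ in atTop,
      (BlockSeq.maxLetters 5 6 m : ℝ≥0∞) ≤ ENNReal.ofReal (C * (m * Real.log (Real.log m)))) ∧
    (∀ d : ℕ, 3 ≤ d → ∃ C : ℝ, 0 < C ∧ ∀ᶠ m : ℕ in atTop,
      (BlockSeq.maxLetters 5 (2 * d + 2) m : ℝ≥0∞) ≤
        ENNReal.ofReal (C * (m * BlockSeq.invHier d m))) := by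
  refine ⟨fun d m hd hm => ?_, BlockSeq.maxLetters_six_lower, BlockSeq.maxLetters_lower,
    BlockSeq.maxLetters_six_upper, fun d hd => BlockSeq.maxLetters_upper d (by omega)⟩
  obtain ⟨d, rfl⟩ := Nat.exists_eq_add_of_le' hd
  obtain ⟨m, rfl⟩ := Nat.exists_eq_add_of_le' hm
  have h := BlockSeq.good_G d m
  exact ⟨h.distinct, fun a ha => h.count_eq ha, h.avoids⟩
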